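/- Let $1\le p<\infty$, $\frac1p+\frac1q=1$, and $n,m,k\in\mathbb N$. For $1\le s\le\infty$ let $W^{1,s}([0,1],\mathbb R^n)$ be the space of absolutely continuous $x:[0,1]\to\mathbb R^n$ with $\dot x\in L^s([0,1],\mathbb R^n)$, with the norm $\|x(0)\|+\|\dot x\|_s$. Put $X=W^{1,p}([0,1],\mathbb R^n)$, $U=L^p([0,1],\mathbb R^m)$, $W=\mathbb R^n\times L^p([0,1],\mathbb R^k)$. Let matrix functions $A,B,C$ on $[0,1]$ with values in $\mathbb R^{n\times n},\mathbb R^{n\times m},\mathbb R^{n\times k}$, functions $g:\mathbb R^n\to\mathbb R$ and $L:[0,1]\times\mathbb R^n\times\mathbb R^m\times\mathbb R^k\to\mathbb R$, $(t,x,u,v)\mapsto L(t,x,u,v)$, and a convex set $\mathcal U\subset U$ be given. Write $L_x,L_u$ and $L_v=L_\theta$ for the partial gradients of $L$ in its last three arguments and $g'$ for the gradient of $g$. For $w=(\alpha,\theta)\in W$ let $$V(w)=\inf\Big\{g(x(1))+\int_0^1L(t,x(t),u(t),\theta(t))\,dt\Big\}\in[-\infty,+\infty],$$ the infimum being over all $(x,u)\in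 X\times U$ with $\dot x(t)=A(t)x(t)+B(t)u(t)+C(t)\theta(t)$ a.e. on $[0,1]$, $x(0)=\alpha$ and $u\in\mathcal U$. Assume: (A1) $A,B,C$ are measurable and essentially bounded. (A2) $g$ is convex and continuously differentiable; $L(\cdot,x,u,v)$ is measurable for all $(x,u,v)$; for a.e. $t$ the function $L(t,\cdot,\cdot,\cdot)$ is convex and continuously differentiable; and there are $c_1,c_2>0$, $r\ge0$, $0\le p_1\le p$, $0\le p_2\le p-1$ and a nonnegative $w_1\in L^p([0,1],\mathbb R)$ such that, for a.e. $t\in[0,1]$ and all $(x,u,v)$, $$|L(t,x,u,v)|\le c_1\big(w_1(t)+\|x\|^{p_1}+\|u\|^{p_1}+\|v\|^{p_1}\big),$$ $$\max\{\|L_x\|,\|L_u\|,\|L_v\|\}(t,x,u,v)\le c_2\big(\|x\|^{p_2}+\|u\|^{p_2}+\|v\|^{p_2}\big)+r .$$ (A3) Every $v\in L^q([0,1],\mathbb R^n)$ with $C^Tv=0$ a.e. satisfies $\int_0^1A^T(t)v(t)\,dt=0$, $B^Tv=0$ a.e., and $v(t)=-\int_0^tA^T(\tau)v(\tau)\,d\tau$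 for a.e. $t$. (A4) The operator $\Phi:W\times(X\times U)\to X$, $\Phi((\alpha,\theta),(x,u))(t)=x(t)-\int_0^tAx\,d\tau-\int_0^tBu\,d\tau-\alpha-\int_0^tC\theta\,d\tau$, has closed range. Suppose that $\operatorname{int}\mathcal U\ne\emptyset$, that $V$ is finite at $\bar w=(\bar\alpha,\bar\theta)\in W$, and that $(\bar x,\bar u)\in X\times U$ is an optimal solution of the problem with parameter $\bar w$. Let $\partial V(\bar w)=\{w^*\in W^*:\langle w^*,w-\bar w\rangle\le V(w)-V(\bar w)\ \forall w\in W\}$ and $N(\bar u;\mathcal U)=\{u^*\in U^*:\langle u^*,u-\bar u\rangle\le0\ \forall u\in\mathcal U\}$, where $(\alpha^*,\theta^*)\in\mathbb R^n\times L^q([0,1],\mathbb R^k)$ and $u^*\in L^q([0,1],\mathbb R^m)$ are regarded as functionals through $\langle\alpha^*,\alpha\rangle+\int_0^1\langle\theta^*(t),\theta(t)\rangle\,dt$ and $\int_0^1\langle u^*(t),u(t)\rangle\,dt$. Below, $L_x,L_u,L_\theta$ are evaluated at $(t,\bar x(t),\bar u(t),\bar\theta(t))$. Then the adjoint problem $$\dot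 y(t)+A^T(t)y(t)=L_x\ \text{ a.e. on }[0,1],\qquad y(1)=-g'(\bar x(1)),$$ has a unique solution $y\in W^{1,q}([0,1],\mathbb R^n)$, the function $u^*(t)=B^T(t)y(t)-L_u$ belongs to $L^q([0,1],\mathbb R^m)$, and $(\alpha^*,\theta^*)\in\mathbb R^n\times L^q([0,1],\mathbb R^k)$ belongs to $\partial V(\bar w)$ if and only if $$\alpha^*=g'(\bar x(1))+\int_0^1L_x\,dt-\int_0^1A^T(t)y(t)\,dt,\qquad \theta^*(t)=-C^T(t)y(t)+L_\theta\ \text{ a.e.},\qquad u^*\in N(\bar u;\mathcal U).$$ Consequently $\partial V(\bar w)$ is either empty or a singleton $\{(\alpha^*,\theta^*)\}$ with $(\alpha^*,\theta^*)\in\mathbb R^n\times L^q([0,1],\mathbb R^k)$. -/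

import Mathlib

open MeasureTheory Set

noncomputable section

namespace ControlSubdiff

/-- Euclidean space `ℝⁿ`. -/
abbrev E (n : ℕ) : Type := EuclideanSpace ℝ (Fin n)

/-- Lebesgue measure on `[0, 1]`. -/
abbrev leb : Measure ℝ := volume.restrict (Icc (0 : ℝ) 1)

/-- The Lebesgue space `L^p([0, 1], ℝⁿ)`. -/
abbrev LpI (p : ENNReal) (n : ℕ) : Type := Lp (E n) p leb

/-- The action of a matrix on Euclidean vectors. -/
def mulE {a b : ℕ} (M : Matrix (Fin a) (Fin b) ℝ) (v : E b) : E a :=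
  WithLp.toLp 2 (M.mulVec v.ofLp)

/-! ### Convex analysis -/

section Convex

variable {F : Type*} [NormedAddCommGroup F] [NormedSpace ℝ F]

/-- The normal cone of convex analysis of the set `S` at `a`. -/
def normalCone (S : Set F) (a : F) : Set (StrongDual ℝ F) :=
  {φ | ∀ x ∈ S, φ (x - a) ≤ 0}

/-- The subdifferential of convex analysis of an extended real valued function `f` at `a`;
it is empty when `f a = +∞`. -/
def subdifferential (f : F → EReal) (a : F) : Set (StrongDual ℝ F) :=
  {φ | f a ≠ ⊤ ∧ ∀ x, ((φ (x - a) : ℝ) : EReal) ≤ f x - f a}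

end Convex

/-! ### The Sobolev space `W^{1,p}([0, 1], ℝⁿ)` -/

/-- The extension of a function on `[0, 1]` to the real line that is constant on `(-∞, 0]` and on
`[1, ∞)`; it lets us write `x t` and `deriv x t` for real `t`. -/
def ext {n : ℕ} (x : Icc (0 : ℝ) 1 → E n) : ℝ → E n := IccExtend zero_le_one x

lemma ext_add {n : ℕ} (x y : Icc (0 : ℝ) 1 → E n) : ext (x + y) = ext x + ext y := rfl

lemma ext_smul {n : ℕ} (c : ℝ) (x : Icc (0 : ℝ) 1 → E n) : ext (c • x) = c • ext x := rfl

lemma ae_differentiableAt {n : ℕ} {f : ℝ → E n} (hf : AbsolutelyContinuousOnInterval f 0 1) :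
    ∀ᵐ t ∂leb, DifferentiableAt ℝ f t := by
  rw [ae_restrict_iff' measurableSet_Icc]
  have := hf.boundedVariationOn.ae_differentiableAt_of_mem_uIcc
  rwa [uIcc_of_le zero_le_one] at this

lemma deriv_add_ae {n : ℕ} {f g : ℝ → E n} (hf : AbsolutelyContinuousOnInterval f 0 1)
    (hg : AbsolutelyContinuousOnInterval g 0 1) :
    deriv (f + g) =ᵐ[leb] deriv f + deriv g := by
  filter_upwards [ae_differentiableAt hf, ae_differentiableAt hg] with t h1 h2
  exact deriv_add h1 h2

lemma deriv_smul_ae {n : ℕ} {f : ℝ → E n} (c : ℝ) (hf : AbsolutelyContinuousOnInterval f 0 1) :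
    deriv (c • f) =ᵐ[leb] c • deriv f := by
  filter_upwards [ae_differentiableAt hf] with t h1
  exact deriv_const_smul c h1

/-- The absolutely continuous functions `x : [0, 1] → ℝⁿ` with derivative in `L^p`. -/
def sobolevSubmodule (p : ENNReal) (n : ℕ) : Submodule ℝ (Icc (0 : ℝ) 1 → E n) where
  carrier := {x | AbsolutelyContinuousOnInterval (ext x) 0 1 ∧ MemLp (deriv (ext x)) p leb}
  add_mem' := by
    rintro x y ⟨hx, hx'⟩ ⟨hy, hy'⟩
    refine ⟨by rw [ext_add]; exact hx.add hy, ?_⟩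
    rw [ext_add]
    exact (memLp_congr_ae (deriv_add_ae hx hy)).2 (hx'.add hy')
  zero_mem' := by
    have h : ext (0 : Icc (0 : ℝ) 1 → E n) = fun _ => 0 := rfl
    refine ⟨?_, ?_⟩
    · rw [h]
      exact contDiffOn_const.absolutelyContinuousOnInterval
    · rw [h, deriv_const']
      exact MemLp.zero'
  smul_mem' := by
    rintro c x ⟨hx, hx'⟩
    refine ⟨by rw [ext_smul]; exact hx.const_smul c, ?_⟩
    rw [ext_smul]
    exact (memLp_congr_ae (deriv_smul_ae c hx)).2 (hx'.const_smul c)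

/-- The Sobolev space `W^{1,p}([0, 1], ℝⁿ)`. -/
def Sobolev (p : ENNReal) (n : ℕ) : Type := sobolevSubmodule p n

namespace Sobolev

variable {p : ENNReal} {n : ℕ}

instance : AddCommGroup (Sobolev p n) := inferInstanceAs (AddCommGroup (sobolevSubmodule p n))

instance : Module ℝ (Sobolev p n) := inferInstanceAs (Module ℝ (sobolevSubmodule p n))

instance : CoeFun (Sobolev p n) (fun _ => ℝ → E n) := ⟨fun x => ext x.1⟩

lemma absCont (x : Sobolev p n) : AbsolutelyContinuousOnInterval x 0 1 := x.2.1

lemma memLp_deriv (x : Sobolev p n) : MemLp (deriv x) p leb := x.2.2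

/-- The linear map `x ↦ (x(0), ẋ)` into `ℝⁿ × L^p`, the latter with the sum of the norms. -/
def initDeriv [Fact (1 ≤ p)] : Sobolev p n →ₗ[ℝ] WithLp 1 (E n × LpI p n) where
  toFun x := WithLp.toLp 1 (x 0, x.memLp_deriv.toLp (deriv x))
  map_add' x y := by
    have h : ((x + y).memLp_deriv).toLp (deriv (x + y : Sobolev p n)) =
        x.memLp_deriv.toLp (deriv x) + y.memLp_deriv.toLp (deriv y) := by
      rw [← MemLp.toLp_add]
      exact MemLp.toLp_congr _ _ (deriv_add_ae x.absCont y.absCont)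
    rw [h]
    rfl
  map_smul' c x := by
    have h : ((c • x).memLp_deriv).toLp (deriv (c • x : Sobolev p n)) =
        c • x.memLp_deriv.toLp (deriv x) := by
      rw [← MemLp.toLp_const_smul]
      exact MemLp.toLp_congr _ _ (deriv_smul_ae c x.absCont)
    rw [h]
    rfl

lemma initDeriv_injective [Fact (1 ≤ p)] :
    Function.Injective (initDeriv : Sobolev p n →ₗ[ℝ] WithLp 1 (E n × LpI p n)) := by
  rw [injective_iff_map_eq_zero]
  intro x hx
  have h0 : x 0 = 0 := congrArg (fun z => z.fst) hx
  have h1 : x.memLp_deriv.toLp (deriv x) = 0 := congrArg (fun z => z.snd) hx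
  have h2 : deriv x =ᵐ[leb] 0 := by
    have := x.memLp_deriv.coeFn_toLp
    rw [h1] at this
    exact this.symm.trans (Lp.coeFn_zero _ _ _)
  have h3 : ∀ᵐ t, t ∈ uIcc (0 : ℝ) 1 → HasDerivAt x 0 t := by
    rw [uIcc_of_le zero_le_one, ← ae_restrict_iff' measurableSet_Icc]
    filter_upwards [h2, ae_differentiableAt x.absCont] with t ht hd
    have := hd.hasDerivAt
    rwa [ht] at this
  obtain ⟨c, hc⟩ := x.absCont.const_of_ae_hasDerivAt_zero h3
  rw [uIcc_of_le zero_le_one] at hc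
  refine Subtype.ext (funext fun t => ?_)
  have ht : x t = 0 := by
    rw [hc t t.2, ← hc 0 (by simp), h0]
  exact (IccExtend_val zero_le_one x.1 t).symm.trans ht

/-- The norm of `W^{1,p}` is `‖x(0)‖ + ‖ẋ‖_p`. -/
instance [Fact (1 ≤ p)] : NormedAddCommGroup (Sobolev p n) :=
  NormedAddCommGroup.induced _ _ (initDeriv : Sobolev p n →ₗ[ℝ] _) initDeriv_injective

instance [Fact (1 ≤ p)] : NormedSpace ℝ (Sobolev p n) :=
  NormedSpace.induced ℝ _ _ (initDeriv : Sobolev p n →ₗ[ℝ] _)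

lemma norm_eq [Fact (1 ≤ p)] (x : Sobolev p n) :
    ‖x‖ = ‖x 0‖ + ‖x.memLp_deriv.toLp (deriv x)‖ :=
  WithLp.prod_norm_eq_of_L1 (initDeriv x)

end Sobolev

/-! ### Duality -/

/-- The inner product of `ℝⁿ` as a continuous bilinear map. -/
def innerB (n : ℕ) : E n →L[ℝ] E n →L[ℝ] ℝ :=
  LinearMap.mkContinuous₂ (innerₗ (E n)) 1 fun x y => by
    simpa using norm_inner_le_norm (𝕜 := ℝ) x y

section Duality

variable {p q : ENNReal} [Fact (1 ≤ p)] [Fact (1 ≤ q)] [ENNReal.HolderConjugate p q]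

variable (p) in
/-- The functional `u ↦ ∫₀¹ ⟨u*(t), u(t)⟩ dt` on `L^p` defined by `u* ∈ L^q`. -/
def dualLp {m : ℕ} (us : LpI q m) : StrongDual ℝ (LpI p m) :=
  (innerB m).lpPairing leb q p us

variable (p) in
/-- The functional `(α, θ) ↦ ⟨α*, α⟩ + ∫₀¹ ⟨θ*(t), θ(t)⟩ dt` on `ℝⁿ × L^p` defined by
`(α*, θ*) ∈ ℝⁿ × L^q`. -/
def dualW {n k : ℕ} (αs : E n) (θs : LpI q k) : StrongDual ℝ (E n × LpI p k) :=
  (innerB n αs).coprod (dualLp p θs)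

lemma dualLp_apply {m : ℕ} (us : LpI q m) (u : LpI p m) :
    dualLp p us u = ∫ t, inner ℝ (us t) (u t) ∂leb :=
  ContinuousLinearMap.lpPairing_eq_integral _ _ _

lemma dualW_apply {n k : ℕ} (αs : E n) (θs : LpI q k) (w : E n × LpI p k) :
    dualW p αs θs w = inner ℝ αs w.1 + ∫ t, inner ℝ (θs t) (w.2 t) ∂leb := by
  rw [← dualLp_apply]
  rfl

end Duality

/-! ### The control problem -/

/-- The data of the parametric control problem: the coefficient matrices, the terminal cost `g`,
the running cost `L`, and the control constraint set `𝒰 ⊆ L^p`. -/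
structure ControlProblem (p : ENNReal) (n m k : ℕ) where
  A : ℝ → Matrix (Fin n) (Fin n) ℝ
  B : ℝ → Matrix (Fin n) (Fin m) ℝ
  C : ℝ → Matrix (Fin n) (Fin k) ℝ
  g : E n → ℝ
  L : ℝ → E n → E m → E k → ℝ
  𝒰 : Set (LpI p m)

/-- A matrix function on `[0, 1]` is measurable and essentially bounded. -/
def MeasEssBdd {a b : ℕ} (M : ℝ → Matrix (Fin a) (Fin b) ℝ) : Prop :=
  (∀ i j, AEMeasurable (fun t => M t i j) leb) ∧
    ∃ γ : ℝ, 0 < γ ∧ ∀ᵐ t ∂leb, ∀ i j, |M t i j| ≤ γ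

namespace ControlProblem

variable {p : ENNReal} {n m k : ℕ} (P : ControlProblem p n m k)

/-- The partial gradient of `L` in the state variable. -/
def Lx (t : ℝ) (x : E n) (u : E m) (v : E k) : E n := gradient (fun x' => P.L t x' u v) x

/-- The partial gradient of `L` in the control variable. -/
def Lu (t : ℝ) (x : E n) (u : E m) (v : E k) : E m := gradient (fun u' => P.L t x u' v) u

/-- The partial gradient of `L` in the parameter variable. -/
def Lv (t : ℝ) (x : E n) (u : E m) (v : E k) : E k := gradient (fun v' => P.L t x u v') v

/-- The objective function `J(x, u, w)`, where `z = (x, u)` and `w = (α, θ)`. -/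
def J (z : Sobolev p n × LpI p m) (w : E n × LpI p k) : ℝ :=
  P.g (z.1 1) + ∫ t in (0 : ℝ)..1, P.L t (z.1 t) (z.2 t) (w.2 t)

/-- The pairs `(x, u)` satisfying the state equation and the initial condition for the parameter
`w = (α, θ)`. -/
def G (w : E n × LpI p k) : Set (Sobolev p n × LpI p m) :=
  {z | (∀ᵐ t ∂leb,
      deriv z.1 t = mulE (P.A t) (z.1 t) + mulE (P.B t) (z.2 t) + mulE (P.C t) (w.2 t)) ∧
    z.1 0 = w.1}

/-- The constraint set `K = W^{1,p} × 𝒰`. -/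
def K : Set (Sobolev p n × LpI p m) := {z | z.2 ∈ P.𝒰}

/-- The optimal value function, with values in `[-∞, +∞]`. -/
def V (w : E n × LpI p k) : EReal := ⨅ z ∈ P.G w ∩ P.K, (P.J z w : EReal)

/-- `z = (x, u)` is a solution of the problem with parameter `w`. -/
def IsSolution (z : Sobolev p n × LpI p m) (w : E n × LpI p k) : Prop :=
  z ∈ P.G w ∩ P.K ∧ ∀ z' ∈ P.G w ∩ P.K, P.J z w ≤ P.J z' w

/-- The coefficient matrices are measurable and essentially bounded. -/
def A1 : Prop := MeasEssBdd P.A ∧ MeasEssBdd P.B ∧ MeasEssBdd P.C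

/-- Convexity, smoothness, measurability and growth of the costs. -/
def A2 : Prop :=
  ConvexOn ℝ univ P.g ∧ ContDiff ℝ 1 P.g ∧
  (∀ x u v, AEMeasurable (fun t => P.L t x u v) leb) ∧
  (∀ᵐ t ∂leb,
    ConvexOn ℝ univ (fun z : E n × E m × E k => P.L t z.1 z.2.1 z.2.2) ∧
    ContDiff ℝ 1 (fun z : E n × E m × E k => P.L t z.1 z.2.1 z.2.2)) ∧
  ∃ (c₁ c₂ r p₁ p₂ : ℝ) (w₁ : ℝ → ℝ),
    0 < c₁ ∧ 0 < c₂ ∧ 0 ≤ r ∧ 0 ≤ p₁ ∧ p₁ ≤ p.toReal ∧ 0 ≤ p₂ ∧ p₂ ≤ p.toReal - 1 ∧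
    (∀ t ∈ Icc (0 : ℝ) 1, 0 ≤ w₁ t) ∧ MemLp w₁ p leb ∧
    ∀ᵐ t ∂leb, ∀ x u v,
      |P.L t x u v| ≤ c₁ * (w₁ t + ‖x‖ ^ p₁ + ‖u‖ ^ p₁ + ‖v‖ ^ p₁) ∧
      max (max ‖P.Lx t x u v‖ ‖P.Lu t x u v‖) ‖P.Lv t x u v‖ ≤
        c₂ * (‖x‖ ^ p₂ + ‖u‖ ^ p₂ + ‖v‖ ^ p₂) + r

/-- `Ψ_A(v) = ∫₀¹ Aᵀ(t) v(t) dt`. -/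
def PsiA {q : ENNReal} (v : LpI q n) : E n := ∫ t in (0 : ℝ)..1, mulE (P.A t).transpose (v t)

/-- `Ψ_B(v)(t) = -Bᵀ(t) v(t)`. -/
def PsiB {q : ENNReal} (v : LpI q n) : ℝ → E m := fun t => -mulE (P.B t).transpose (v t)

/-- `Ψ_C(v)(t) = Cᵀ(t) v(t)`. -/
def PsiC {q : ENNReal} (v : LpI q n) : ℝ → E k := fun t => mulE (P.C t).transpose (v t)

/-- `Ψ(v)(t) = -∫₀ᵗ Aᵀ(τ) v(τ) dτ`. -/
def Psi {q : ENNReal} (v : LpI q n) : ℝ → E n :=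
  fun t => -∫ τ in (0 : ℝ)..t, mulE (P.A τ).transpose (v τ)

/-- The inclusion `ker Ψ_C ⊆ ker Ψ_A ∩ ker Ψ_B ∩ Fix Ψ` in `L^q`. -/
def A3 (q : ENNReal) : Prop :=
  {v : LpI q n | P.PsiC v =ᵐ[leb] 0} ⊆
    {v : LpI q n | P.PsiA v = 0} ∩ {v : LpI q n | P.PsiB v =ᵐ[leb] 0} ∩
      {v : LpI q n | P.Psi v =ᵐ[leb] v}

/-- `Φ(w, z) = x - ∫₀ A x - ∫₀ B u - α - ∫₀ C θ` as a function on `[0, 1]`, where `z = (x, u)` and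
`w = (α, θ)`. -/
def Phi (w : E n × LpI p k) (z : Sobolev p n × LpI p m) (t : ℝ) : E n :=
  z.1 t - (∫ τ in (0 : ℝ)..t, mulE (P.A τ) (z.1 τ)) - (∫ τ in (0 : ℝ)..t, mulE (P.B τ) (z.2 τ))
    - w.1 - ∫ τ in (0 : ℝ)..t, mulE (P.C τ) (w.2 τ)

/-- The range of `Φ` is closed in `W^{1,p}`. -/
def A4 [Fact (1 ≤ p)] : Prop :=
  IsClosed {y : Sobolev p n | ∃ w z, ∀ t ∈ Icc (0 : ℝ) 1, y t = P.Phi w z t}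

/-- `y` solves the adjoint terminal value problem along `(x, u)` for the parameter `w`. -/
def SolvesAdjoint {q : ENNReal} (z : Sobolev p n × LpI p m) (w : E n × LpI p k)
    (y : Sobolev q n) : Prop :=
  (∀ᵐ t ∂leb,
    deriv y t + mulE (P.A t).transpose (y t) = P.Lx t (z.1 t) (z.2 t) (w.2 t)) ∧
  y 1 = -gradient P.g (z.1 1)

end ControlProblem

end ControlSubdiff

end

/-!
The state equation is linear with bounded measurable coefficients, so every initial value, control
and parameter determine a trajectory (`existsUnique_linearODE`). The integral equation is solved by
a contraction in the exponentially weighted sup norm, which works equally well from the initial and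
from the terminal time and hence also yields the unique solution `y` of the adjoint problem.

Write `z = (x̄, ū)` and let `δ` be the derivative of the convex objective `J` at `(z, w̄)` in the
direction of another feasible pair (`firstVariation`). Convexity gives `δ ≤ J(z', w') - J(z, w̄)`,
and moving along the segment from `(z, w̄)` to `(z', w')`, which stays feasible, gives `δ` as a
limit of difference quotients. Hence `φ ∈ ∂V(w̄)` if and only if `φ(w' - w̄) ≤ δ` for all feasible
pairs (`mem_subdifferential_V_iff_le_firstVariation`).

Integrating `⟨y, x' - x̄⟩` by parts eliminates the state increment from the first variation
(`firstVariation_eq`): `δ = ⟨(α₀, θ₀), w' - w̄⟩ - ⟨u*, u' - ū⟩` with `α₀ = -y(0)`,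
`θ₀ = -Cᵀ y + L_θ` and `u* = Bᵀ y - L_u`. Since `w'` and `u' ∈ 𝒰` can be varied independently, the
inequality `φ(w' - w̄) ≤ δ` splits into `φ = (α₀, θ₀)` and `u* ∈ N(ū; 𝒰)`
(`mem_subdifferential_V_iff_eq_dualW`). The formula for `α₀` in terms of the terminal data is the
fundamental theorem of calculus applied to `y`.
-/

noncomputable section

namespace ControlSubdiff

open Filter Topology

/-! ### Lebesgue measure on the unit interval and matrix actions -/

lemma integral_leb {F : Type*} [NormedAddCommGroup F] [NormedSpace ℝ F] (f : ℝ → F) :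
    ∫ t in (0 : ℝ)..1, f t = ∫ t, f t ∂leb := by
  rw [intervalIntegral.integral_of_le zero_le_one, integral_Icc_eq_integral_Ioc]

lemma intervalIntegrable_of_integrable_leb {F : Type*} [NormedAddCommGroup F] {f : ℝ → F}
    (hf : Integrable f leb) {a t : ℝ} (ha : a ∈ Icc (0 : ℝ) 1) (ht : t ∈ Icc (0 : ℝ) 1) :
    IntervalIntegrable f volume a t := by
  rw [intervalIntegrable_iff]
  refine IntegrableOn.mono_set (t := Icc 0 1) hf ?_
  exact uIoc_subset_uIcc.trans (uIcc_subset_Icc ha ht)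

lemma ae_restrict_uIoc_of_ae_leb {Q : ℝ → Prop} (h : ∀ᵐ t ∂leb, Q t) {a t : ℝ}
    (ha : a ∈ Icc (0 : ℝ) 1) (ht : t ∈ Icc (0 : ℝ) 1) :
    ∀ᵐ s ∂(volume.restrict (uIoc a t)), Q s :=
  ae_restrict_of_ae_restrict_of_subset
    (uIoc_subset_uIcc.trans (uIcc_subset_Icc ha ht)) h

lemma ae_leb_mem_Ioo : ∀ᵐ t ∂leb, t ∈ Ioo (0 : ℝ) 1 := by
  rw [leb, ← Measure.restrict_congr_set Ioo_ae_eq_Icc]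
  exact ae_restrict_mem measurableSet_Ioo

@[simp] lemma mulE_apply {a b : ℕ} (M : Matrix (Fin a) (Fin b) ℝ) (v : E b) (i : Fin a) :
    mulE M v i = ∑ j, M i j * v j := rfl

lemma mulE_add {a b : ℕ} (M : Matrix (Fin a) (Fin b) ℝ) (v w : E b) :
    mulE M (v + w) = mulE M v + mulE M w := by
  simp [mulE, Matrix.mulVec_add]

lemma mulE_sub {a b : ℕ} (M : Matrix (Fin a) (Fin b) ℝ) (v w : E b) :
    mulE M (v - w) = mulE M v - mulE M w := by
  simp [mulE, Matrix.mulVec_sub]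

lemma mulE_smul {a b : ℕ} (M : Matrix (Fin a) (Fin b) ℝ) (c : ℝ) (v : E b) :
    mulE M (c • v) = c • mulE M v := by
  simp [mulE, Matrix.mulVec_smul]

lemma mulE_neg {a b : ℕ} (M : Matrix (Fin a) (Fin b) ℝ) (v : E b) :
    mulE (-M) v = -mulE M v := by
  simp [mulE, Matrix.neg_mulVec]

lemma inner_mulE_transpose {a b : ℕ} (M : Matrix (Fin a) (Fin b) ℝ) (v : E a) (w : E b) :
    inner ℝ (mulE M.transpose v) w = inner ℝ v (mulE M w) := by
  simp only [PiLp.inner_apply, mulE_apply, Matrix.transpose_apply, RCLike.inner_apply, conj_trivial,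
    Finset.mul_sum, Finset.sum_mul]
  rw [Finset.sum_comm]
  exact Finset.sum_congr rfl fun i _ => Finset.sum_congr rfl fun j _ => by ring

lemma norm_mulE_le {a b : ℕ} {M : Matrix (Fin a) (Fin b) ℝ} {γ : ℝ}
    (h : ∀ i j, |M i j| ≤ γ) (v : E b) : ‖mulE M v‖ ≤ (a * (b * γ)) * ‖v‖ := by
  have hsum : ‖mulE M v‖ ≤ ∑ i, ‖mulE M v i‖ := by
    conv_lhs => rw [← (EuclideanSpace.basisFun (Fin a) ℝ).sum_repr (mulE M v)]
    refine (norm_sum_le _ _).trans (Finset.sum_le_sum fun i _ => ?_)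
    simp [norm_smul]
  refine hsum.trans ?_
  have hi : ∀ i ∈ Finset.univ, ‖mulE M v i‖ ≤ b * γ * ‖v‖ := fun i _ => by
    rw [mulE_apply]
    refine (norm_sum_le _ _).trans ?_
    have : ∀ j ∈ Finset.univ, ‖M i j * v j‖ ≤ γ * ‖v‖ := fun j _ => by
      rw [norm_mul]
      exact mul_le_mul (h i j) (PiLp.norm_apply_le v j) (norm_nonneg _)
        ((abs_nonneg _).trans (h i j))
    refine (Finset.sum_le_sum this).trans ?_
    simp [mul_assoc]
  refine (Finset.sum_le_sum hi).trans ?_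
  simp [mul_assoc]

namespace MeasEssBdd

variable {a b : ℕ} {M : ℝ → Matrix (Fin a) (Fin b) ℝ}

lemma transpose (h : MeasEssBdd M) : MeasEssBdd (fun t => (M t).transpose) := by
  obtain ⟨h1, γ, hγ, h2⟩ := h
  exact ⟨fun i j => h1 j i, γ, hγ, h2.mono fun t ht i j => ht j i⟩

lemma neg (h : MeasEssBdd M) : MeasEssBdd (fun t => -M t) := by
  obtain ⟨h1, γ, hγ, h2⟩ := h
  exact ⟨fun i j => (h1 i j).neg, γ, hγ, h2.mono fun t ht i j => by simpa using ht i j⟩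

lemma exists_bound (h : MeasEssBdd M) :
    ∃ K : ℝ, 0 < K ∧ ∀ᵐ t ∂leb, ∀ v, ‖mulE (M t) v‖ ≤ K * ‖v‖ := by
  obtain ⟨-, γ, hγ, h2⟩ := h
  refine ⟨a * (b * γ) + 1, by positivity, h2.mono fun t ht v => ?_⟩
  exact (norm_mulE_le ht v).trans (by gcongr; linarith)

lemma aestronglyMeasurable (h : MeasEssBdd M) {v : ℝ → E b}
    (hv : AEStronglyMeasurable v leb) : AEStronglyMeasurable (fun t => mulE (M t) (v t)) leb := by
  have : AEMeasurable (fun t => mulE (M t) (v t)) leb := by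
    refine (WithLp.measurable_toLp 2 (Fin a → ℝ)).comp_aemeasurable ?_
    refine aemeasurable_pi_lambda _ fun i => ?_
    simp only [Matrix.mulVec, dotProduct]
    refine Finset.aemeasurable_fun_sum _ fun j _ => (h.1 i j).mul ?_
    have : Measurable fun w : E b => w j := (by fun_prop : Continuous fun w : E b => w j).measurable
    exact this.comp_aemeasurable hv.aemeasurable
  exact this.aestronglyMeasurable

lemma memLp (h : MeasEssBdd M) {s : ENNReal} {v : ℝ → E b} (hv : MemLp v s leb) :
    MemLp (fun t => mulE (M t) (v t)) s leb := by
  obtain ⟨K, -, hK⟩ := h.exists_bound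
  exact hv.of_le_mul (h.aestronglyMeasurable hv.1) (hK.mono fun t ht => ht (v t))

end MeasEssBdd

/-! ### Absolutely continuous functions and primitives -/

/-- Absolute continuity passes to functions with smaller increments. It transfers the theory of
real-valued absolutely continuous functions to vector-valued ones. -/
lemma absolutelyContinuousOnInterval_of_dist_le {X Y : Type*} [PseudoMetricSpace X]
    [PseudoMetricSpace Y] {f : ℝ → X} {g : ℝ → Y} {a b : ℝ}
    (hg : AbsolutelyContinuousOnInterval g a b)
    (h : ∀ x ∈ uIcc a b, ∀ y ∈ uIcc a b, dist (f x) (f y) ≤ dist (g x) (g y)) :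
    AbsolutelyContinuousOnInterval f a b := by
  refine squeeze_zero' (Eventually.of_forall fun _ => Finset.sum_nonneg fun _ _ => dist_nonneg)
    ?_ hg
  rw [eventually_inf_principal]
  filter_upwards with I hI
  exact Finset.sum_le_sum fun i hi => h _ (hI.1 i hi).1 _ (hI.1 i hi).2

lemma absolutelyContinuousOnInterval_primitive {n : ℕ} {f : ℝ → E n} (hf : Integrable f leb)
    {a : ℝ} (ha : a ∈ Icc (0 : ℝ) 1) :
    AbsolutelyContinuousOnInterval (fun t => ∫ s in a..t, f s) 0 1 := by
  have h01 : uIcc (0 : ℝ) 1 = Icc 0 1 := uIcc_of_le zero_le_one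
  refine absolutelyContinuousOnInterval_of_dist_le
    ((intervalIntegrable_of_integrable_leb hf.norm (left_mem_Icc.2 zero_le_one)
      (right_mem_Icc.2 zero_le_one)).absolutelyContinuousOnInterval_intervalIntegral
      (h01 ▸ ha)) fun x hx y hy => ?_
  rw [h01] at hx hy
  rw [dist_eq_norm, Real.dist_eq,
    intervalIntegral.integral_interval_sub_left (intervalIntegrable_of_integrable_leb hf ha hx)
      (intervalIntegrable_of_integrable_leb hf ha hy),
    intervalIntegral.integral_interval_sub_left (intervalIntegrable_of_integrable_leb hf.norm ha hx)
      (intervalIntegrable_of_integrable_leb hf.norm ha hy)]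
  exact intervalIntegral.norm_integral_le_abs_integral_norm

lemma ae_hasDerivAt_primitive {n : ℕ} {f : ℝ → E n} (hf : Integrable f leb)
    {a : ℝ} (ha : a ∈ Icc (0 : ℝ) 1) :
    ∀ᵐ t ∂leb, HasDerivAt (fun t => ∫ s in a..t, f s) (f t) t := by
  have h01 : uIcc (0 : ℝ) 1 = Icc 0 1 := uIcc_of_le zero_le_one
  rw [ae_restrict_iff' measurableSet_Icc]
  filter_upwards [(intervalIntegrable_of_integrable_leb hf (left_mem_Icc.2 zero_le_one)
      (right_mem_Icc.2 zero_le_one)).ae_hasDerivAt_integral] with t ht h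
  rw [h01] at ht
  exact ht h a ha

lemma absolutelyContinuousOnInterval_inner {n : ℕ} {f g : ℝ → E n}
    (hf : AbsolutelyContinuousOnInterval f 0 1) (hg : AbsolutelyContinuousOnInterval g 0 1) :
    AbsolutelyContinuousOnInterval (fun t => inner ℝ (f t) (g t)) 0 1 := by
  have hc : ∀ {h : ℝ → E n}, AbsolutelyContinuousOnInterval h 0 1 → ∀ i,
      AbsolutelyContinuousOnInterval (fun t => h t i) 0 1 := fun hh i =>
    absolutelyContinuousOnInterval_of_dist_le hh fun x _ y _ => PiLp.dist_apply_le _ _ i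
  have hsum : ∀ S : Finset (Fin n),
      AbsolutelyContinuousOnInterval (fun t => ∑ i ∈ S, g t i * f t i) 0 1 := fun S => by
    induction S using Finset.induction_on with
    | empty => simpa using contDiffOn_const.absolutelyContinuousOnInterval
    | insert i S hi ih =>
      simp only [Finset.sum_insert hi]
      exact ((hc hg i).fun_mul (hc hf i)).fun_add ih
  simpa [PiLp.inner_apply] using hsum Finset.univ

lemma ext_apply {n : ℕ} (x : Icc (0 : ℝ) 1 → E n) {t : ℝ} (ht : t ∈ Icc (0 : ℝ) 1) :
    ext x t = x ⟨t, ht⟩ := IccExtend_of_mem zero_le_one x ht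

namespace Sobolev

variable {p : ENNReal} {n : ℕ}

lemma ext_of_eqOn {x y : Sobolev p n} (h : ∀ t ∈ Icc (0 : ℝ) 1, x t = y t) : x = y := by
  refine Subtype.ext (funext fun t => ?_)
  rw [← IccExtend_val zero_le_one x.1 t, ← IccExtend_val zero_le_one y.1 t]
  exact h t t.2

lemma continuousOn (x : Sobolev p n) : ContinuousOn x (Icc (0 : ℝ) 1) := by
  have := x.absCont.continuousOn
  rwa [uIcc_of_le zero_le_one] at this

lemma aestronglyMeasurable (x : Sobolev p n) : AEStronglyMeasurable x leb :=
  x.continuousOn.aestronglyMeasurable measurableSet_Icc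

lemma memLp_top (x : Sobolev p n) : MemLp x ⊤ leb := by
  obtain ⟨C, hC⟩ := x.absCont.exists_bound
  rw [uIcc_of_le zero_le_one] at hC
  refine memLp_top_of_bound x.aestronglyMeasurable C ?_
  filter_upwards [ae_restrict_mem measurableSet_Icc] with t ht using hC t ht

lemma memLp (x : Sobolev p n) (s : ENNReal) : MemLp x s leb :=
  x.memLp_top.mono_exponent le_top

lemma integrable_deriv [Fact (1 ≤ p)] (x : Sobolev p n) : Integrable (deriv x) leb :=
  x.memLp_deriv.integrable Fact.out

/-- The fundamental theorem of calculus in `W^{1,p}`. -/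
lemma eq_add_integral_deriv [Fact (1 ≤ p)] (x : Sobolev p n) {a t : ℝ} (ha : a ∈ Icc (0 : ℝ) 1)
    (ht : t ∈ Icc (0 : ℝ) 1) : x t = x a + ∫ s in a..t, deriv x s := by
  have h01 : uIcc (0 : ℝ) 1 = Icc 0 1 := uIcc_of_le zero_le_one
  have hac := x.absCont.fun_sub (absolutelyContinuousOnInterval_primitive x.integrable_deriv ha)
  have hd : ∀ᵐ t, t ∈ uIcc (0 : ℝ) 1 →
      HasDerivAt (fun t => x t - ∫ s in a..t, deriv x s) 0 t := by
    rw [h01, ← ae_restrict_iff' measurableSet_Icc]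
    filter_upwards [ae_differentiableAt x.absCont,
      ae_hasDerivAt_primitive x.integrable_deriv ha] with t h1 h2
    simpa using h1.hasDerivAt.fun_sub h2
  obtain ⟨c, hc⟩ := hac.const_of_ae_hasDerivAt_zero hd
  rw [h01] at hc
  have e1 := hc t ht
  have e2 := hc a ha
  simp only [intervalIntegral.integral_same, sub_zero] at e2
  rw [e2, ← e1]
  abel

/-- Primitives of `L^p` functions, with any base point in `[0, 1]`, belong to `W^{1,p}`. -/
lemma exists_primitive {h : ℝ → E n} [Fact (1 ≤ p)] (hh : MemLp h p leb) {a : ℝ}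
    (ha : a ∈ Icc (0 : ℝ) 1) (b : E n) :
    ∃ x : Sobolev p n, (∀ t ∈ Icc (0 : ℝ) 1, x t = b + ∫ s in a..t, h s) ∧
      deriv x =ᵐ[leb] h := by
  have hi : Integrable h leb := hh.integrable Fact.out
  set X : Icc (0 : ℝ) 1 → E n := fun t => b + ∫ s in a..t, h s with hX
  have hXt : ∀ t ∈ Icc (0 : ℝ) 1, ext X t = b + ∫ s in a..t, h s := fun t ht => ext_apply X ht
  have hac : AbsolutelyContinuousOnInterval (ext X) 0 1 := by
    refine absolutelyContinuousOnInterval_of_dist_le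
      (absolutelyContinuousOnInterval_primitive hi ha) fun s hs t ht => ?_
    rw [uIcc_of_le zero_le_one] at hs ht
    rw [hXt s hs, hXt t ht, dist_add_left]
  have hd : deriv (ext X) =ᵐ[leb] h := by
    filter_upwards [ae_hasDerivAt_primitive hi ha, ae_leb_mem_Ioo] with t ht h01
    have : ext X =ᶠ[𝓝 t] fun t => b + ∫ s in a..t, h s := by
      filter_upwards [Icc_mem_nhds h01.1 h01.2] with s hs using hXt s hs
    rw [this.deriv_eq]
    exact (ht.const_add b).deriv
  exact ⟨⟨X, hac, (memLp_congr_ae hd).2 hh⟩, hXt, hd⟩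

/-- Integration by parts for the Euclidean inner product of absolutely continuous functions. -/
lemma integral_inner_deriv {q : ENNReal} (y : Sobolev q n) (x : Sobolev p n) :
    ∫ t, (inner ℝ (y t) (deriv x t) + inner ℝ (deriv y t) (x t)) ∂leb =
      inner ℝ (y 1) (x 1) - inner ℝ (y 0) (x 0) := by
  rw [← (absolutelyContinuousOnInterval_inner y.absCont x.absCont).integral_deriv_eq_sub,
    integral_leb]
  refine integral_congr_ae ?_
  filter_upwards [ae_differentiableAt x.absCont, ae_differentiableAt y.absCont] with t h1 h2
  exact ((h2.hasDerivAt.inner ℝ h1.hasDerivAt).deriv).symm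

end Sobolev

/-! ### Linear differential equations with bounded measurable coefficients -/

section LinearODE

variable {n : ℕ}

/-- The integrand of the integral equation for `ẋ = M x + f` in the weighted unknown
`z(t) = exp (-μ (t - a)) x(t)`. -/
def weightedField (M : ℝ → Matrix (Fin n) (Fin n) ℝ) (f : ℝ → E n) (μ a : ℝ)
    (z : C(Icc (0 : ℝ) 1, E n)) (s : ℝ) : E n :=
  mulE (M s) (Real.exp (μ * (s - a)) • ext z s) + f s

lemma memLp_weightedField {M : ℝ → Matrix (Fin n) (Fin n) ℝ} (hM : MeasEssBdd M)
    {f : ℝ → E n} {p : ENNReal} (hf : MemLp f p leb) (μ a : ℝ)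
    (z : C(Icc (0 : ℝ) 1, E n)) : MemLp (weightedField M f μ a z) p leb := by
  have hz : Continuous fun s => Real.exp (μ * (s - a)) • ext z s :=
    (by fun_prop : Continuous fun s => Real.exp (μ * (s - a))).smul
      (z.continuous.Icc_extend' (h := zero_le_one))
  obtain ⟨C, hC⟩ := isCompact_Icc.exists_bound_of_continuousOn (s := Icc (0 : ℝ) 1)
    hz.continuousOn
  have : MemLp (fun s => Real.exp (μ * (s - a)) • ext z s) ⊤ leb :=
    memLp_top_of_bound hz.aestronglyMeasurable C
      ((ae_restrict_mem measurableSet_Icc).mono fun t ht => hC t ht)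
  exact (hM.memLp (this.mono_exponent le_top)).add hf

/-- The integral operator whose fixed points are the weighted solutions of `ẋ = M x + f`,
`x(a) = b`. -/
def weightedPicard {M : ℝ → Matrix (Fin n) (Fin n) ℝ} (hM : MeasEssBdd M)
    {f : ℝ → E n} (hf : Integrable f leb) (μ : ℝ) {a : ℝ} (ha : a ∈ Icc (0 : ℝ) 1) (b : E n)
    (z : C(Icc (0 : ℝ) 1, E n)) : C(Icc (0 : ℝ) 1, E n) where
  toFun t := Real.exp (-(μ * (t - a))) • (b + ∫ s in a..t, weightedField M f μ a z s)
  continuous_toFun := by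
    have hi := memLp_one_iff_integrable.1
      (memLp_weightedField hM (memLp_one_iff_integrable.2 hf) μ a z)
    have hc := (absolutelyContinuousOnInterval_primitive hi ha).continuousOn
    rw [uIcc_of_le zero_le_one] at hc
    have := continuousOn_iff_continuous_domRestrict.1 hc
    exact (by fun_prop : Continuous fun t : Icc (0 : ℝ) 1 => Real.exp (-(μ * (t - a)))).smul
      (continuous_const.add this)

lemma abs_integral_exp_le {μ a t : ℝ} (hμ : μ ≠ 0) :
    |∫ s in a..t, Real.exp (μ * (s - a))| ≤ |Real.exp (μ * (t - a)) - 1| / |μ| := by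
  have : ∫ s in a..t, Real.exp (μ * (s - a)) = (Real.exp (μ * (t - a)) - 1) / μ := by
    rw [intervalIntegral.integral_comp_sub_right (fun s => Real.exp (μ * s)),
      intervalIntegral.integral_comp_mul_left _ hμ, integral_exp]
    simp [div_eq_inv_mul]
  rw [this, abs_div]

/-- In the exponentially weighted unknown the integral operator contracts: the weight grows away
from the base point `a` at a rate exceeding the bound of the coefficient matrix. -/
lemma contractingWith_weightedPicard {M : ℝ → Matrix (Fin n) (Fin n) ℝ} (hM : MeasEssBdd M)
    {f : ℝ → E n} (hf : Integrable f leb) {μ K : ℝ} {a : ℝ} (ha : a ∈ Icc (0 : ℝ) 1) (b : E n)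
    (hK : 0 < K) (hMK : ∀ᵐ t ∂leb, ∀ v, ‖mulE (M t) v‖ ≤ K * ‖v‖) (hμ : |μ| = 2 * K)
    (hμa : ∀ t ∈ Icc (0 : ℝ) 1, 0 ≤ μ * (t - a)) :
    ContractingWith (1 / 2) (weightedPicard hM hf μ ha b) := by
  refine ⟨by rw [← NNReal.coe_lt_coe]; norm_num, LipschitzWith.of_dist_le_mul fun z w => ?_⟩
  rw [ContinuousMap.dist_le (by positivity)]
  intro t
  have hi : ∀ z, Integrable (weightedField M f μ a z) leb := fun z => memLp_one_iff_integrable.1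
    (memLp_weightedField hM (memLp_one_iff_integrable.2 hf) μ a z)
  have hμ0 : μ ≠ 0 := by
    rintro rfl
    simp at hμ
    exact hK.ne' hμ
  have hdiff : ‖∫ s in a..t, (weightedField M f μ a z s - weightedField M f μ a w s)‖ ≤
      |∫ s in a..t, K * dist z w * Real.exp (μ * (s - a))| := by
    refine intervalIntegral.norm_integral_le_abs_of_norm_le ?_
      ((by fun_prop : Continuous fun s => K * dist z w * Real.exp (μ * (s - a))).intervalIntegrable
        _ _)
    have hmem : ∀ᵐ s ∂leb, s ∈ Icc (0 : ℝ) 1 := ae_restrict_mem measurableSet_Icc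
    filter_upwards [ae_restrict_uIoc_of_ae_leb hMK ha t.2,
      ae_restrict_uIoc_of_ae_leb hmem ha t.2] with s hs hs01
    have e : weightedField M f μ a z s - weightedField M f μ a w s =
        mulE (M s) (Real.exp (μ * (s - a)) • (ext z s - ext w s)) := by
      simp only [weightedField, smul_sub, mulE_sub]
      abel
    rw [e]
    refine (hs _).trans ?_
    rw [norm_smul, Real.norm_of_nonneg (Real.exp_pos _).le, ext_apply _ hs01, ext_apply _ hs01,
      ← dist_eq_norm, mul_comm (Real.exp _), ← mul_assoc]
    gcongr
    exact ContinuousMap.dist_apply_le_dist _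
  rw [intervalIntegral.integral_const_mul, abs_mul, abs_of_nonneg (by positivity)] at hdiff
  have hexp : Real.exp (-(μ * (t - a))) * |Real.exp (μ * (t - a)) - 1| ≤ 1 := by
    have h1 : 1 ≤ Real.exp (μ * (t - a)) := Real.one_le_exp (hμa t t.2)
    rw [abs_of_nonneg (by linarith), mul_sub, ← Real.exp_add]
    have := Real.exp_pos (-(μ * (t - a)))
    simp only [neg_add_cancel, Real.exp_zero]
    linarith
  have hsub : weightedPicard hM hf μ ha b z t - weightedPicard hM hf μ ha b w t =
      Real.exp (-(μ * (t - a))) •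
        ∫ s in a..t, (weightedField M f μ a z s - weightedField M f μ a w s) := by
    rw [intervalIntegral.integral_sub (intervalIntegrable_of_integrable_leb (hi z) ha t.2)
      (intervalIntegrable_of_integrable_leb (hi w) ha t.2)]
    simp only [weightedPicard, ContinuousMap.coe_mk, ← smul_sub]
    congr 1
    abel
  rw [dist_eq_norm, hsub, norm_smul, Real.norm_of_nonneg (Real.exp_pos _).le]
  calc _ ≤ Real.exp (-(μ * (t - a))) * (K * dist z w * (|Real.exp (μ * (t - a)) - 1| / |μ|)) := by
        gcongr
        refine hdiff.trans ?_
        gcongr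
        exact abs_integral_exp_le hμ0
    _ = (Real.exp (-(μ * (t - a))) * |Real.exp (μ * (t - a)) - 1|) * (dist z w / 2) := by
        rw [hμ]
        field_simp
    _ ≤ 1 * (dist z w / 2) := by gcongr
    _ = _ := by
        simp
        ring

/-- Initial (`a = 0`) and terminal (`a = 1`) value problems for a linear equation with measurable
essentially bounded coefficients and a forcing term in `L^p` are uniquely solvable in `W^{1,p}`. -/
theorem existsUnique_linearODE {p : ENNReal} [Fact (1 ≤ p)] {M : ℝ → Matrix (Fin n) (Fin n) ℝ}
    (hM : MeasEssBdd M) {f : ℝ → E n} (hf : MemLp f p leb) {a : ℝ} (ha : a = 0 ∨ a = 1)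
    (b : E n) :
    ∃! x : Sobolev p n, (∀ᵐ t ∂leb, deriv x t = mulE (M t) (x t) + f t) ∧ x a = b := by
  have hfi : Integrable f leb := hf.integrable Fact.out
  obtain ⟨K, hK, hMK⟩ := hM.exists_bound
  have ha01 : a ∈ Icc (0 : ℝ) 1 := by rcases ha with rfl | rfl <;> simp
  -- The sign of the exponent makes the weight grow away from the base point in `[0, 1]`.
  obtain ⟨μ, hμ, hμa⟩ : ∃ μ : ℝ, |μ| = 2 * K ∧ ∀ t ∈ Icc (0 : ℝ) 1, 0 ≤ μ * (t - a) := by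
    rcases ha with rfl | rfl
    · exact ⟨2 * K, abs_of_pos (by positivity), fun t ht => by have := ht.1; simp; positivity⟩
    · refine ⟨-(2 * K), by rw [abs_neg, abs_of_pos (by positivity)], fun t ht => ?_⟩
      have := mul_nonneg hK.le (sub_nonneg.2 ht.2)
      linarith
  have hT := contractingWith_weightedPicard hM hfi ha01 b hK hMK hμ hμa
  have hcancel : ∀ c : ℝ, ∀ v : E n, Real.exp c • Real.exp (-c) • v = v := fun c v => by
    rw [smul_smul, ← Real.exp_add, add_neg_cancel, Real.exp_zero, one_smul]
  obtain ⟨z, hfix, huniq⟩ : ∃ z : C(Icc (0 : ℝ) 1, E n), weightedPicard hM hfi μ ha01 b z = z ∧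
      ∀ w, weightedPicard hM hfi μ ha01 b w = w → w = z :=
    ⟨_, hT.fixedPoint_isFixedPt, fun w hw => hT.fixedPoint_unique hw⟩
  refine existsUnique_of_exists_of_unique ?_ ?_
  · obtain ⟨x, hx, hdx⟩ :=
      Sobolev.exists_primitive (memLp_weightedField hM hf μ a z) ha01 b
    refine ⟨x, ?_, by simpa using hx a ha01⟩
    filter_upwards [hdx, ae_restrict_mem measurableSet_Icc] with t ht h01
    rw [ht, weightedField, ext_apply _ h01]
    congr 2
    conv_lhs => rw [← hfix]
    simp only [weightedPicard, ContinuousMap.coe_mk]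
    rw [hcancel, hx t h01]
  · -- A solution, multiplied by the weight, is a fixed point of the integral operator.
    have key : ∀ x : Sobolev p n,
        (∀ᵐ t ∂leb, deriv x t = mulE (M t) (x t) + f t) ∧ x a = b →
        ∀ t ∈ Icc (0 : ℝ) 1, Real.exp (-(μ * (t - a))) • x t = ext z t := by
      rintro x ⟨hx, hxa⟩
      let w : C(Icc (0 : ℝ) 1, E n) := ⟨fun t => Real.exp (-(μ * (t - a))) • x t,
        (by fun_prop : Continuous fun t : Icc (0 : ℝ) 1 => Real.exp (-(μ * (t - a)))).smul
          (continuousOn_iff_continuous_domRestrict.1 x.continuousOn)⟩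
      have hw : weightedPicard hM hfi μ ha01 b w = w := by
        ext1 t
        simp only [weightedPicard, ContinuousMap.coe_mk, w]
        congr 1
        rw [x.eq_add_integral_deriv ha01 t.2, hxa]
        congr 1
        refine intervalIntegral.integral_congr_ae_restrict ?_
        have hmem : ∀ᵐ s ∂leb, s ∈ Icc (0 : ℝ) 1 := ae_restrict_mem measurableSet_Icc
        filter_upwards [ae_restrict_uIoc_of_ae_leb hx ha01 t.2,
          ae_restrict_uIoc_of_ae_leb hmem ha01 t.2] with s hs h01
        rw [hs, weightedField, ext_apply _ h01]
        simp only [ContinuousMap.coe_mk, hcancel]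
      intro t ht
      rw [← huniq w hw]
      exact (ext_apply w ht).symm
    intro x y hx hy
    refine Sobolev.ext_of_eqOn fun t ht => ?_
    have := (key x hx t ht).trans (key y hy t ht).symm
    exact smul_right_injective _ (Real.exp_pos _).ne' this

end LinearODE

/-! ### Integrability of compositions -/

/-- Composition of a Carathéodory function with a measurable function is measurable. -/
lemma aemeasurable_caratheodory {α Z : Type*} [MeasurableSpace α] {μ : Measure α}
    [TopologicalSpace Z] {f : α → Z → ℝ} (hm : ∀ z, AEMeasurable (fun t => f t z) μ)
    (hc : ∀ᵐ t ∂μ, Continuous (f t)) {ζ : α → Z} (hζ : AEStronglyMeasurable ζ μ) :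
    AEMeasurable (fun t => f t (ζ t)) μ := by
  have hs := hζ.stronglyMeasurable_mk
  refine aemeasurable_of_tendsto_metrizable_ae' (f := fun j t => f t (hs.approx j t))
    (fun j => ?_) ?_
  · classical
    have : (fun t => f t (hs.approx j t)) = fun t => ∑ z ∈ (hs.approx j).range,
        ((hs.approx j) ⁻¹' {z}).indicator (fun t => f t z) t := by
      funext t
      rw [Finset.sum_eq_single (hs.approx j t)]
      · simp
      · intro z _ hz
        exact indicator_of_notMem (by simpa using hz.symm) _
      · intro h
        exact absurd (SimpleFunc.mem_range_self _ t) h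
    rw [this]
    exact Finset.aemeasurable_fun_sum _ fun z _ =>
      (hm z).indicator ((hs.approx j).measurableSet_fiber z)
  · filter_upwards [hc, hζ.ae_eq_mk] with t ht he
    rw [he]
    exact (ht.tendsto _).comp (hs.tendsto_approx t)

lemma integrable_inner_of_conjugate {p q : ENNReal} [ENNReal.HolderConjugate p q] {n : ℕ}
    {f g : ℝ → E n} (hf : MemLp f q leb) (hg : MemLp g p leb) :
    Integrable (fun t => inner ℝ (f t) (g t)) leb := by
  have hqp : ENNReal.HolderConjugate q p := ENNReal.HolderConjugate.symm
  rw [← memLp_one_iff_integrable]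
  refine MemLp.of_bilin (r := 1) (fun a b => inner ℝ a b) 1 hf hg (hf.1.inner hg.1) ?_
  filter_upwards with t
  simpa using nnnorm_inner_le_nnnorm (𝕜 := ℝ) (f t) (g t)

lemma memLp_norm_rpow {p s : ENNReal} {n : ℕ} {r : ℝ} (hr : 0 ≤ r) {f : ℝ → E n}
    (hp0 : p ≠ 0) (hf : MemLp f p leb) (h : s * ENNReal.ofReal r ≤ p) :
    MemLp (fun t => ‖f t‖ ^ r) s leb := by
  have := hf.norm_rpow_div (ENNReal.ofReal r)
  rw [ENNReal.toReal_ofReal hr] at this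
  refine this.mono_exponent ?_
  exact (ENNReal.le_div_iff_mul_le (Or.inr hp0) (Or.inl ENNReal.ofReal_ne_top)).2 h

/-- The growth exponent `p - 1` of the gradients is the one that maps `L^p` into `L^q`; at `p = 1`,
`q = ∞` only `r ≤ 0` is left. -/
lemma conjugate_mul_ofReal_le {p q : ENNReal} [ENNReal.HolderConjugate p q]
    (hp : p ≠ ⊤) {r : ℝ} (hr : r ≤ p.toReal - 1) : q * ENNReal.ofReal r ≤ p := by
  rcases le_or_gt r 0 with h0 | h0
  · simp [ENNReal.ofReal_of_nonpos h0]
  have hc := ENNReal.HolderConjugate.toReal (p := p) (q := q) (by linarith)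
  have hq : q ≠ ⊤ := by
    rintro rfl
    simpa using hc.symm.pos
  rw [← ENNReal.ofReal_toReal hp, ← ENNReal.ofReal_toReal hq,
    ← ENNReal.ofReal_mul ENNReal.toReal_nonneg]
  refine ENNReal.ofReal_le_ofReal ?_
  rw [← hc.sub_one_mul_conj, mul_comm]
  exact mul_le_mul_of_nonneg_right hr ENNReal.toReal_nonneg

/-! ### Convex functions along lines -/

section Convex

variable {Z : Type*} [AddCommGroup Z] [Module ℝ Z] {f : Z → ℝ} {z d : Z}

lemma convex_quotient_le (hf : ConvexOn ℝ univ f) {s : ℝ} (hs : 0 < s) (hs1 : s ≤ 1) :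
    s⁻¹ * (f (z + s • d) - f z) ≤ f (z + d) - f z := by
  have h := hf.2 (mem_univ z) (mem_univ (z + d)) (sub_nonneg.2 hs1) hs.le (by ring)
  have e : (1 - s) • z + s • (z + d) = z + s • d := by module
  rw [e, smul_eq_mul, smul_eq_mul] at h
  rw [inv_mul_le_iff₀ hs]
  linarith

lemma convex_deriv_le (hf : ConvexOn ℝ univ f) {D : ℝ}
    (hD : HasDerivAt (fun s : ℝ => f (z + s • d)) D 0) : D ≤ f (z + d) - f z := by
  have h := hD.tendsto_slope_zero_right
  refine le_of_tendsto h ?_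
  filter_upwards [Ioc_mem_nhdsGT (zero_lt_one' ℝ)] with s hs
  simpa using convex_quotient_le (z := z) (d := d) hf hs.1 hs.2

lemma convex_deriv_le_quotient (hf : ConvexOn ℝ univ f) {D : ℝ}
    (hD : HasDerivAt (fun s : ℝ => f (z + s • d)) D 0) {s : ℝ} (hs : 0 < s) :
    D ≤ s⁻¹ * (f (z + s • d) - f z) := by
  have hD' : HasDerivAt (fun r : ℝ => f (z + r • s • d)) (D * s) 0 := by
    have hl : HasDerivAt (fun r : ℝ => r * s) s 0 := by simpa using (hasDerivAt_id 0).mul_const s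
    have : HasDerivAt (fun s : ℝ => f (z + s • d)) D (0 * s) := by simpa using hD
    simpa [Function.comp_def, mul_smul] using this.comp 0 hl
  rw [le_inv_mul_iff₀ hs, mul_comm]
  exact convex_deriv_le hf hD'

end Convex

/-! ### The costs and their directional derivatives -/

namespace ControlProblem

variable {p : ENNReal} {n m k : ℕ} (P : ControlProblem p n m k)

/-- The derivative of `L(t, ·)` at `(x, u, v)` in the direction `(dx, du, dv)`. -/
def dL (t : ℝ) (x : E n) (u : E m) (v : E k) (dx : E n) (du : E m) (dv : E k) : ℝ :=
  inner ℝ (P.Lx t x u v) dx + inner ℝ (P.Lu t x u v) du + inner ℝ (P.Lv t x u v) dv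

variable {P}

lemma hasDerivAt_L {t : ℝ}
    (h : ContDiff ℝ 1 (fun z : E n × E m × E k => P.L t z.1 z.2.1 z.2.2))
    (x : E n) (u : E m) (v : E k) (dx : E n) (du : E m) (dv : E k) :
    HasDerivAt (fun s : ℝ => P.L t (x + s • dx) (u + s • du) (v + s • dv))
      (P.dL t x u v dx du dv) 0 := by
  set F : E n × E m × E k → ℝ := fun z => P.L t z.1 z.2.1 z.2.2 with hF
  have hd : HasFDerivAt F (fderiv ℝ F (x, u, v)) (x, u, v) :=
    (h.differentiable one_ne_zero _).hasFDerivAt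
  have hx : inner ℝ (P.Lx t x u v) dx = fderiv ℝ F (x, u, v) (dx, 0, 0) := by
    have := hd.comp x (hasFDerivAt_prodMk_left (𝕜 := ℝ) x (u, v))
    rw [Lx, inner_gradient_left]
    have e := this.fderiv
    simp only [Function.comp_def, hF] at e
    rw [e]
    simp [hF]
    rfl
  have hu : inner ℝ (P.Lu t x u v) du = fderiv ℝ F (x, u, v) (0, du, 0) := by
    have := hd.comp u
      ((hasFDerivAt_prodMk_right (𝕜 := ℝ) x (u, v)).comp u (hasFDerivAt_prodMk_left (𝕜 := ℝ) u v))
    rw [Lu, inner_gradient_left]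
    have e := this.fderiv
    simp only [Function.comp_def, hF] at e
    rw [e]
    simp [hF]
  have hv : inner ℝ (P.Lv t x u v) dv = fderiv ℝ F (x, u, v) (0, 0, dv) := by
    have := hd.comp v
      ((hasFDerivAt_prodMk_right (𝕜 := ℝ) x (u, v)).comp v (hasFDerivAt_prodMk_right (𝕜 := ℝ) u v))
    rw [Lv, inner_gradient_left]
    have e := this.fderiv
    simp only [Function.comp_def, hF] at e
    rw [e]
    simp [hF]
  have hsum : P.dL t x u v dx du dv = fderiv ℝ F (x, u, v) (dx, du, dv) := by
    rw [dL, hx, hu, hv, ← map_add, ← map_add]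
    simp
  rw [hsum]
  have hline : HasDerivAt (fun s : ℝ => (x, u, v) + s • (dx, du, dv)) (dx, du, dv) 0 := by
    simpa using ((hasDerivAt_id (0 : ℝ)).smul_const (dx, du, dv)).const_add (x, u, v)
  have hd' : HasFDerivAt F (fderiv ℝ F (x, u, v)) ((x, u, v) + (0 : ℝ) • (dx, du, dv)) := by
    simpa using hd
  exact hd'.comp_hasDerivAt 0 hline

lemma hasDerivAt_g (h2 : P.A2) (x d : E n) :
    HasDerivAt (fun s : ℝ => P.g (x + s • d)) (inner ℝ (gradient P.g x) d) 0 := by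
  have hline : HasDerivAt (fun s : ℝ => x + s • d) d 0 := by
    simpa using ((hasDerivAt_id (0 : ℝ)).smul_const d).const_add x
  have hd : HasFDerivAt P.g (fderiv ℝ P.g x) (x + (0 : ℝ) • d) := by
    simpa using (h2.2.1.differentiable one_ne_zero x).hasFDerivAt
  rw [inner_gradient_left]
  exact hd.comp_hasDerivAt 0 hline

section Trajectory

variable {x : ℝ → E n} {u : ℝ → E m} {v : ℝ → E k}

lemma aemeasurable_L (h2 : P.A2) (hx : AEStronglyMeasurable x leb)
    (hu : AEStronglyMeasurable u leb) (hv : AEStronglyMeasurable v leb) :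
    AEMeasurable (fun t => P.L t (x t) (u t) (v t)) leb := by
  obtain ⟨-, -, hm, hc, -⟩ := h2
  exact aemeasurable_caratheodory (f := fun t (z : E n × E m × E k) => P.L t z.1 z.2.1 z.2.2)
    (fun z => hm _ _ _) (hc.mono fun t ht => ht.2.continuous) (hx.prodMk (hu.prodMk hv))

/-- Directional derivatives along a trajectory are measurable as limits of difference quotients. -/
lemma aemeasurable_dL (h2 : P.A2) (hx : AEStronglyMeasurable x leb)
    (hu : AEStronglyMeasurable u leb) (hv : AEStronglyMeasurable v leb)
    (dx : E n) (du : E m) (dv : E k) :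
    AEMeasurable (fun t => P.dL t (x t) (u t) (v t) dx du dv) leb := by
  have hs : Tendsto (fun j : ℕ => (1 : ℝ) / (j + 1)) atTop (𝓝[>] 0) :=
    tendsto_nhdsWithin_iff.2 ⟨tendsto_one_div_add_atTop_nhds_zero_nat,
      Eventually.of_forall fun j => by simp only [mem_Ioi]; positivity⟩
  refine aemeasurable_of_tendsto_metrizable_ae' (f := fun (j : ℕ) t =>
    ((1 : ℝ) / (j + 1))⁻¹ * (P.L t (x t + ((1 : ℝ) / (j + 1)) • dx) (u t + ((1 : ℝ) / (j + 1)) • du)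
      (v t + ((1 : ℝ) / (j + 1)) • dv) - P.L t (x t) (u t) (v t))) (fun j => ?_) ?_
  · exact ((aemeasurable_L h2 (hx.add aestronglyMeasurable_const)
      (hu.add aestronglyMeasurable_const) (hv.add aestronglyMeasurable_const)).sub
      (aemeasurable_L h2 hx hu hv)).const_mul _
  · filter_upwards [h2.2.2.2.1] with t ht
    simpa [Function.comp_def] using (hasDerivAt_L ht.2 (x t) (u t) (v t) dx du dv
      |>.tendsto_slope_zero_right).comp hs

lemma aestronglyMeasurable_of_inner {a : ℕ} {f : ℝ → E a}
    (h : ∀ w : E a, AEMeasurable (fun t => inner ℝ (f t) w) leb) :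
    AEStronglyMeasurable f leb := by
  have : AEMeasurable (fun t => WithLp.toLp 2 fun i => f t i) leb := by
    refine (WithLp.measurable_toLp 2 (Fin a → ℝ)).comp_aemeasurable ?_
    refine aemeasurable_pi_lambda _ fun i => ?_
    simpa [EuclideanSpace.inner_single_right] using h (EuclideanSpace.single i 1)
  exact this.aestronglyMeasurable

variable [hp1 : Fact (1 ≤ p)]

lemma integrable_L (h2 : P.A2) (hx : MemLp x p leb) (hu : MemLp u p leb)
    (hv : MemLp v p leb) : Integrable (fun t => P.L t (x t) (u t) (v t)) leb := by
  have hp0 : p ≠ 0 := (zero_lt_one.trans_le hp1.out).ne'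
  have hm := aemeasurable_L h2 hx.1 hu.1 hv.1
  obtain ⟨-, -, -, -, c₁, c₂, r, p₁, p₂, w₁, -, -, -, h0, hp₁, -, -, -, hw, hb⟩ := h2
  have hle : (1 : ENNReal) * ENNReal.ofReal p₁ ≤ p := by
    rw [one_mul]
    exact (ENNReal.ofReal_le_ofReal hp₁).trans ENNReal.ofReal_toReal_le
  have hi : ∀ {a : ℕ} {f : ℝ → E a}, MemLp f p leb → Integrable (fun t => ‖f t‖ ^ p₁) leb :=
    fun hf => memLp_one_iff_integrable.1 (memLp_norm_rpow h0 hp0 hf hle)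
  refine Integrable.mono' ((((hw.integrable hp1.out).add (hi hx)).add (hi hu)).add
    (hi hv) |>.const_mul c₁) hm.aestronglyMeasurable (hb.mono fun t ht => ?_)
  exact (ht _ _ _).1

/-- Along `L^p` trajectories the partial gradients of the running cost belong to the dual space
`L^q`. -/
lemma memLp_gradients {q : ENNReal} [ENNReal.HolderConjugate p q] (h2 : P.A2) (hp : p ≠ ⊤)
    (hx : MemLp x p leb) (hu : MemLp u p leb) (hv : MemLp v p leb) :
    MemLp (fun t => P.Lx t (x t) (u t) (v t)) q leb ∧
      MemLp (fun t => P.Lu t (x t) (u t) (v t)) q leb ∧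
      MemLp (fun t => P.Lv t (x t) (u t) (v t)) q leb := by
  have hp0 : p ≠ 0 := (zero_lt_one.trans_le hp1.out).ne'
  have hm := aemeasurable_dL h2 hx.1 hu.1 hv.1
  obtain ⟨-, -, -, -, c₁, c₂, r, p₁, p₂, w₁, -, -, -, -, -, h0, hp₂, -, -, hb⟩ := h2
  have hi : ∀ {a : ℕ} {f : ℝ → E a}, MemLp f p leb → MemLp (fun t => ‖f t‖ ^ p₂) q leb :=
    fun hf => memLp_norm_rpow h0 hp0 hf (conjugate_mul_ofReal_le hp hp₂)
  have hbd := (((hi hx).add (hi hu)).add (hi hv) |>.const_mul c₂).add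
    (memLp_const (μ := leb) (p := q) r)
  have hb' := hb.mono fun t ht => (ht (x t) (u t) (v t)).2
  refine ⟨hbd.mono' (aestronglyMeasurable_of_inner fun w => ?_) (hb'.mono fun t ht => ?_),
    hbd.mono' (aestronglyMeasurable_of_inner fun w => ?_) (hb'.mono fun t ht => ?_),
    hbd.mono' (aestronglyMeasurable_of_inner fun w => ?_) (hb'.mono fun t ht => ?_)⟩
  · simpa [dL] using hm w 0 0
  · exact ((le_max_left _ _).trans (le_max_left _ _)).trans ht
  · simpa [dL] using hm 0 w 0
  · exact ((le_max_right _ _).trans (le_max_left _ _)).trans ht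
  · simpa [dL] using hm 0 0 w
  · exact (le_max_right _ _).trans ht

variable {dx : ℝ → E n} {du : ℝ → E m} {dv : ℝ → E k}

lemma integrable_dL (q : ENNReal) [ENNReal.HolderConjugate p q] (h2 : P.A2) (hp : p ≠ ⊤)
    (hx : MemLp x p leb) (hu : MemLp u p leb) (hv : MemLp v p leb)
    (hdx : MemLp dx p leb) (hdu : MemLp du p leb) (hdv : MemLp dv p leb) :
    Integrable (fun t => P.dL t (x t) (u t) (v t) (dx t) (du t) (dv t)) leb := by
  obtain ⟨h1, h2, h3⟩ := memLp_gradients (q := q) h2 hp hx hu hv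
  exact ((integrable_inner_of_conjugate (p := p) h1 hdx).add
    (integrable_inner_of_conjugate (p := p) h2 hdu)).add
    (integrable_inner_of_conjugate (p := p) h3 hdv)

lemma integral_dL_le (q : ENNReal) [ENNReal.HolderConjugate p q] (h2 : P.A2) (hp : p ≠ ⊤)
    (hx : MemLp x p leb) (hu : MemLp u p leb) (hv : MemLp v p leb)
    (hdx : MemLp dx p leb) (hdu : MemLp du p leb) (hdv : MemLp dv p leb) :
    ∫ t, P.dL t (x t) (u t) (v t) (dx t) (du t) (dv t) ∂leb ≤
      (∫ t, P.L t (x t + dx t) (u t + du t) (v t + dv t) ∂leb) -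
        ∫ t, P.L t (x t) (u t) (v t) ∂leb := by
  have hi1 : Integrable (fun t => P.L t (x t + dx t) (u t + du t) (v t + dv t)) leb :=
    integrable_L h2 (hx.add hdx) (hu.add hdu) (hv.add hdv)
  have hi2 := integrable_L h2 hx hu hv
  rw [← integral_sub hi1 hi2]
  refine integral_mono_ae (integrable_dL q h2 hp hx hu hv hdx hdu hdv) (hi1.sub hi2) ?_
  filter_upwards [h2.2.2.2.1] with t ht
  exact convex_deriv_le (z := (x t, u t, v t)) (d := (dx t, du t, dv t)) ht.1
    (hasDerivAt_L ht.2 _ _ _ _ _ _)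

/-- The integral cost has the expected one-sided directional derivatives. By convexity the
difference quotients lie between the derivative and the increment over the unit step, and these
two integrable functions give the domination. -/
lemma tendsto_quotient_integral_L (q : ENNReal) [ENNReal.HolderConjugate p q] (h2 : P.A2)
    (hp : p ≠ ⊤) (hx : MemLp x p leb) (hu : MemLp u p leb) (hv : MemLp v p leb)
    (hdx : MemLp dx p leb) (hdu : MemLp du p leb) (hdv : MemLp dv p leb) :
    Tendsto (fun s : ℝ => s⁻¹ *
      ((∫ t, P.L t (x t + s • dx t) (u t + s • du t) (v t + s • dv t) ∂leb) -
        ∫ t, P.L t (x t) (u t) (v t) ∂leb)) (𝓝[>] 0)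
      (𝓝 (∫ t, P.dL t (x t) (u t) (v t) (dx t) (du t) (dv t) ∂leb)) := by
  have hi : ∀ s : ℝ, Integrable
      (fun t => P.L t (x t + s • dx t) (u t + s • du t) (v t + s • dv t)) leb := fun s =>
    integrable_L h2 (hx.add (hdx.const_smul s)) (hu.add (hdu.const_smul s))
      (hv.add (hdv.const_smul s))
  have hi1 : Integrable (fun t => P.L t (x t + dx t) (u t + du t) (v t + dv t)) leb :=
    integrable_L h2 (hx.add hdx) (hu.add hdu) (hv.add hdv)
  have hi0 := integrable_L h2 hx hu hv
  have hid := integrable_dL q h2 hp hx hu hv hdx hdu hdv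
  simp_rw [← integral_sub (hi _) hi0, ← integral_const_mul]
  refine tendsto_integral_filter_of_dominated_convergence
    (fun t => |P.dL t (x t) (u t) (v t) (dx t) (du t) (dv t)| +
      |P.L t (x t + dx t) (u t + du t) (v t + dv t) - P.L t (x t) (u t) (v t)|)
    (Eventually.of_forall fun s => (((hi s).sub hi0).const_mul _).1) ?_
    (hid.abs.add (hi1.sub hi0).abs) ?_
  · filter_upwards [Ioc_mem_nhdsGT (zero_lt_one' ℝ)] with s hs
    filter_upwards [h2.2.2.2.1] with t ht
    have hl := convex_deriv_le_quotient (z := (x t, u t, v t)) (d := (dx t, du t, dv t)) ht.1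
      (hasDerivAt_L ht.2 _ _ _ _ _ _) hs.1
    have hr := convex_quotient_le (z := (x t, u t, v t)) (d := (dx t, du t, dv t)) ht.1 hs.1 hs.2
    simp only [Prod.fst_add, Prod.snd_add, Prod.smul_fst, Prod.smul_snd] at hl hr
    rw [Real.norm_eq_abs]
    refine (abs_le_max_abs_abs hl hr).trans ?_
    exact max_le (le_add_of_nonneg_right (abs_nonneg _)) (le_add_of_nonneg_left (abs_nonneg _))
  · filter_upwards [h2.2.2.2.1] with t ht
    simpa using (hasDerivAt_L ht.2 (x t) (u t) (v t) (dx t) (du t) (dv t)).tendsto_slope_zero_right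

end Trajectory

end ControlProblem

/-! ### Injectivity of the dual pairings -/

section Pairing

variable {p q : ENNReal} [Fact (1 ≤ p)] [Fact (1 ≤ q)] [ENNReal.HolderConjugate p q]

/-- An element of `L^q` is determined by its integral functional on `L^p`, also for `q = ∞`. -/
lemma dualLp_injective {m : ℕ} : Function.Injective (dualLp p : LpI q m → _) := by
  suffices h : ∀ f : LpI q m, dualLp p f = 0 → f = 0 by
    intro f g hfg
    refine sub_eq_zero.1 (h _ ?_)
    have : dualLp p (f - g) = dualLp p f - dualLp p g := map_sub _ _ _
    rw [this, hfg, sub_self]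
  intro f hf
  -- The bounded function `(1 + ‖f‖)⁻¹ • f` tests `f` against itself.
  have hm : AEStronglyMeasurable (fun t => (1 + ‖f t‖)⁻¹ • f t) leb :=
    ((aestronglyMeasurable_const.add (Lp.aestronglyMeasurable f).norm).aemeasurable.inv
      |>.aestronglyMeasurable).smul (Lp.aestronglyMeasurable f)
  have hb : MemLp (fun t => (1 + ‖f t‖)⁻¹ • f t) p leb := by
    refine MemLp.of_bound hm 1 (Eventually.of_forall fun t => ?_)
    rw [norm_smul, Real.norm_of_nonneg (by positivity), inv_mul_le_iff₀ (by positivity)]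
    linarith
  have h0 : dualLp p f (hb.toLp _) = 0 := by rw [hf]; rfl
  rw [dualLp_apply] at h0
  have hint := integrable_inner_of_conjugate (p := p) (Lp.memLp f) hb
  have hcongr : ∀ᵐ t ∂leb, inner ℝ (f t) (hb.toLp _ t) =
      inner ℝ (f t) ((1 + ‖f t‖)⁻¹ • f t) := by
    filter_upwards [hb.coeFn_toLp] with t ht
    rw [ht]
  rw [integral_congr_ae hcongr, integral_eq_zero_iff_of_nonneg (fun t => by
    simp only [Pi.zero_apply, inner_smul_right, real_inner_self_eq_norm_sq]
    positivity) hint] at h0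
  rw [Lp.eq_zero_iff_ae_eq_zero]
  filter_upwards [h0] with t ht
  have h1 : (1 + ‖f t‖)⁻¹ ≠ 0 := by positivity
  simpa [inner_smul_right, h1] using ht

lemma dualW_inj {n k : ℕ} {α β : E n} {θ η : LpI q k} :
    dualW p α θ = dualW p β η ↔ α = β ∧ θ = η := by
  refine ⟨fun h => ⟨?_, ?_⟩, by rintro ⟨rfl, rfl⟩; rfl⟩
  · refine ext_inner_right ℝ fun v => ?_
    have := DFunLike.congr_fun h (v, 0)
    simpa [dualW, innerB] using this
  · refine dualLp_injective (p := p) (ContinuousLinearMap.ext fun v => ?_)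
    have := DFunLike.congr_fun h (0, v)
    simpa [dualW] using this

end Pairing

namespace Sobolev

variable {p : ENNReal} {n : ℕ}

lemma coe_add_smul_sub (x y : Sobolev p n) (s : ℝ) (t : ℝ) :
    (x + s • (y - x) : Sobolev p n) t = x t + s • (y t - x t) := rfl

lemma deriv_add_smul_sub (x y : Sobolev p n) (s : ℝ) :
    ∀ᵐ t ∂leb, deriv (x + s • (y - x) : Sobolev p n) t =
      deriv x t + s • (deriv y t - deriv x t) := by
  filter_upwards [ae_differentiableAt x.absCont, ae_differentiableAt y.absCont] with t hx hy
  exact (hx.hasDerivAt.add ((hy.hasDerivAt.sub hx.hasDerivAt).const_smul s)).deriv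

lemma deriv_sub (x y : Sobolev p n) :
    ∀ᵐ t ∂leb, deriv (y - x : Sobolev p n) t = deriv y t - deriv x t := by
  filter_upwards [ae_differentiableAt x.absCont, ae_differentiableAt y.absCont] with t hx hy
  exact (hy.hasDerivAt.sub hx.hasDerivAt).deriv

end Sobolev

lemma coeFn_add_smul_sub {p : ENNReal} {m : ℕ} (u v : LpI p m) (s : ℝ) :
    ∀ᵐ t ∂leb, (u + s • (v - u) : LpI p m) t = u t + s • (v t - u t) := by
  filter_upwards [Lp.coeFn_add u (s • (v - u)), Lp.coeFn_smul s (v - u), Lp.coeFn_sub v u]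
    with t h1 h2 h3
  rw [h1, Pi.add_apply, h2, Pi.smul_apply, h3, Pi.sub_apply]

namespace ControlProblem

variable {p : ENNReal} {n m k : ℕ} {P : ControlProblem p n m k}

/-! ### The feasible set and the value function -/

lemma add_smul_sub_mem_G {w w' : E n × LpI p k} {z z' : Sobolev p n × LpI p m}
    (hz : z ∈ P.G w) (hz' : z' ∈ P.G w') (s : ℝ) :
    z + s • (z' - z) ∈ P.G (w + s • (w' - w)) := by
  refine ⟨?_, ?_⟩
  · filter_upwards [hz.1, hz'.1, Sobolev.deriv_add_smul_sub z.1 z'.1 s,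
      coeFn_add_smul_sub z.2 z'.2 s, coeFn_add_smul_sub w.2 w'.2 s] with t h1 h2 h3 h4 h5
    have e1 : (z + s • (z' - z)).1 = z.1 + s • (z'.1 - z.1) := rfl
    have e2 : (z + s • (z' - z)).2 = z.2 + s • (z'.2 - z.2) := rfl
    have e3 : (w + s • (w' - w)).2 = w.2 + s • (w'.2 - w.2) := rfl
    rw [e1, e2, e3, h3, h4, h5, h1, h2, Sobolev.coe_add_smul_sub]
    simp only [mulE_add, mulE_smul, mulE_sub, smul_sub, smul_add]
    abel
  · have h1 := hz.2
    have h2 := hz'.2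
    change z.1 0 + s • (z'.1 0 - z.1 0) = w.1 + s • (w'.1 - w.1)
    rw [h1, h2]

lemma IsSolution.V_eq {w : E n × LpI p k} {z : Sobolev p n × LpI p m} (h : P.IsSolution z w) :
    P.V w = (P.J z w : EReal) :=
  le_antisymm (iInf₂_le z h.1) (le_iInf₂ fun z' hz' => EReal.coe_le_coe_iff.2 (h.2 z' hz'))

variable [Fact (1 ≤ p)]

lemma exists_mem_G (h1 : P.A1) (w : E n × LpI p k) (u : LpI p m) :
    ∃ x : Sobolev p n, (x, u) ∈ P.G w := by
  obtain ⟨hA, hB, hC⟩ := h1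
  obtain ⟨x, ⟨hx, hx0⟩, -⟩ := existsUnique_linearODE hA
    ((hB.memLp (Lp.memLp u)).add (hC.memLp (Lp.memLp w.2))) (Or.inl rfl) w.1
  refine ⟨x, ?_, hx0⟩
  filter_upwards [hx] with t ht
  rw [ht, add_assoc]
  rfl

/-- At a solvable parameter the subgradient inequality for the extended real value function is a
family of real inequalities, one for each feasible pair. -/
lemma mem_subdifferential_V_iff {w : E n × LpI p k} {z : Sobolev p n × LpI p m}
    (h : P.IsSolution z w) (φ : StrongDual ℝ (E n × LpI p k)) :
    φ ∈ subdifferential P.V w ↔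
      ∀ w', ∀ z' ∈ P.G w' ∩ P.K, φ (w' - w) ≤ P.J z' w' - P.J z w := by
  have hle : ∀ w', ((φ (w' - w) : ℝ) : EReal) ≤ P.V w' - (P.J z w : EReal) ↔
      ∀ z' ∈ P.G w' ∩ P.K, φ (w' - w) ≤ P.J z' w' - P.J z w := fun w' => by
    rw [EReal.le_sub_iff_add_le (Or.inl (EReal.coe_ne_bot _)) (Or.inl (EReal.coe_ne_top _)), V,
      le_iInf₂_iff]
    refine forall₂_congr fun z' _ => ?_
    rw [← EReal.coe_add, EReal.coe_le_coe_iff, le_sub_iff_add_le]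
  simp only [subdifferential, mem_ofPred_eq, h.V_eq, hle]
  exact and_iff_right (EReal.coe_ne_top _)

/-! ### The first variation of the objective -/

/-- The derivative of the objective at `(z, w)` in the direction `(z' - z, w' - w)`. -/
def firstVariation (P : ControlProblem p n m k) (z : Sobolev p n × LpI p m) (w : E n × LpI p k)
    (z' : Sobolev p n × LpI p m) (w' : E n × LpI p k) : ℝ :=
  inner ℝ (gradient P.g (z.1 1)) (z'.1 1 - z.1 1) +
    ∫ t, P.dL t (z.1 t) (z.2 t) (w.2 t) (z'.1 t - z.1 t) (z'.2 t - z.2 t) (w'.2 t - w.2 t) ∂leb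

lemma firstVariation_le (q : ENNReal) [ENNReal.HolderConjugate p q] (h2 : P.A2) (hp : p ≠ ⊤)
    (z z' : Sobolev p n × LpI p m) (w w' : E n × LpI p k) :
    P.firstVariation z w z' w' ≤ P.J z' w' - P.J z w := by
  have hg := convex_deriv_le h2.1 (hasDerivAt_g h2 (z.1 1) (z'.1 1 - z.1 1))
  have hL := integral_dL_le q h2 hp (z.1.memLp p) (Lp.memLp z.2) (Lp.memLp w.2)
    ((z'.1.memLp p).sub (z.1.memLp p)) ((Lp.memLp z'.2).sub (Lp.memLp z.2))
    ((Lp.memLp w'.2).sub (Lp.memLp w.2))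
  simp only [Pi.sub_apply, add_sub_cancel] at hg hL
  simp only [firstVariation, J, integral_leb]
  linarith

lemma tendsto_quotient_J (q : ENNReal) [ENNReal.HolderConjugate p q] (h2 : P.A2) (hp : p ≠ ⊤)
    (z z' : Sobolev p n × LpI p m) (w w' : E n × LpI p k) :
    Tendsto (fun s : ℝ => s⁻¹ * (P.J (z + s • (z' - z)) (w + s • (w' - w)) - P.J z w)) (𝓝[>] 0)
      (𝓝 (P.firstVariation z w z' w')) := by
  have hg := (hasDerivAt_g h2 (z.1 1) (z'.1 1 - z.1 1)).tendsto_slope_zero_right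
  have hL := tendsto_quotient_integral_L q h2 hp (z.1.memLp p) (Lp.memLp z.2) (Lp.memLp w.2)
    ((z'.1.memLp p).sub (z.1.memLp p)) ((Lp.memLp z'.2).sub (Lp.memLp z.2))
    ((Lp.memLp w'.2).sub (Lp.memLp w.2))
  refine (hg.add hL).congr fun s => ?_
  have hs : ∫ t, P.L t ((z + s • (z' - z)).1 t) ((z + s • (z' - z)).2 t)
      ((w + s • (w' - w)).2 t) ∂leb =
      ∫ t, P.L t (z.1 t + s • (z'.1 t - z.1 t)) (z.2 t + s • (z'.2 t - z.2 t))
        (w.2 t + s • (w'.2 t - w.2 t)) ∂leb := by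
    refine integral_congr_ae ?_
    filter_upwards [coeFn_add_smul_sub z.2 z'.2 s, coeFn_add_smul_sub w.2 w'.2 s] with t h4 h5
    have e1 : (z + s • (z' - z)).1 t = z.1 t + s • (z'.1 t - z.1 t) := rfl
    have e2 : (z + s • (z' - z)).2 = z.2 + s • (z'.2 - z.2) := rfl
    have e3 : (w + s • (w' - w)).2 = w.2 + s • (w'.2 - w.2) := rfl
    rw [e1, e2, e3, h4, h5]
  have h1 : (z + s • (z' - z)).1 1 = z.1 1 + s • (z'.1 1 - z.1 1) := rfl
  simp only [J, integral_leb, hs, h1, Pi.sub_apply, smul_eq_mul, zero_add, zero_smul, add_zero]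
  ring

/-- The adjoint state turns the first variation along feasible directions into a functional of the
parameter and the control increments alone. -/
lemma firstVariation_eq {q : ENNReal} [Fact (1 ≤ q)] [ENNReal.HolderConjugate p q] (h2 : P.A2)
    (hp : p ≠ ⊤) {z z' : Sobolev p n × LpI p m}
    {w w' : E n × LpI p k} (hz : z ∈ P.G w) (hz' : z' ∈ P.G w') {y : Sobolev q n}
    (hy : P.SolvesAdjoint z w y) {us : LpI q m} {θs : LpI q k}
    (hus : ∀ᵐ t ∂leb, us t = mulE (P.B t).transpose (y t) - P.Lu t (z.1 t) (z.2 t) (w.2 t))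
    (hθs : ∀ᵐ t ∂leb, θs t = -mulE (P.C t).transpose (y t) + P.Lv t (z.1 t) (z.2 t) (w.2 t)) :
    P.firstVariation z w z' w' = dualW p (-y 0) θs (w' - w) - dualLp p us (z'.2 - z.2) := by
  have hparts := Sobolev.integral_inner_deriv y (z'.1 - z.1)
  have c0 : (z'.1 - z.1 : Sobolev p n) 0 = (w' - w).1 := by
    change z'.1 0 - z.1 0 = w'.1 - w.1
    rw [hz.2, hz'.2]
  have c1 : (z'.1 - z.1 : Sobolev p n) 1 = z'.1 1 - z.1 1 := rfl
  have hdL := integrable_dL q h2 hp (z.1.memLp p) (Lp.memLp z.2) (Lp.memLp w.2)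
    ((z'.1.memLp p).sub (z.1.memLp p)) ((Lp.memLp z'.2).sub (Lp.memLp z.2))
    ((Lp.memLp w'.2).sub (Lp.memLp w.2))
  have hiu := integrable_inner_of_conjugate (p := p) (Lp.memLp us) (Lp.memLp (z'.2 - z.2))
  have hiv := integrable_inner_of_conjugate (p := p) (Lp.memLp θs) (Lp.memLp (w' - w).2)
  have hpt : ∀ᵐ t ∂leb, inner ℝ (y t) (deriv (z'.1 - z.1 : Sobolev p n) t) +
      inner ℝ (deriv y t) ((z'.1 - z.1 : Sobolev p n) t) =
      P.dL t (z.1 t) (z.2 t) (w.2 t) (z'.1 t - z.1 t) (z'.2 t - z.2 t) (w'.2 t - w.2 t) +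
        inner ℝ (us t) ((z'.2 - z.2) t) - inner ℝ (θs t) ((w' - w).2 t) := by
    filter_upwards [hz.1, hz'.1, hy.1, hus, hθs, Sobolev.deriv_sub z.1 z'.1,
      Lp.coeFn_sub z'.2 z.2, Lp.coeFn_sub w'.2 w.2] with t e1 e2 e3 e4 e5 e6 e7 e8
    have e9 : (w' - w).2 = w'.2 - w.2 := rfl
    have e10 : (z'.1 - z.1 : Sobolev p n) t = z'.1 t - z.1 t := rfl
    rw [e4, e5, e6, e7, e9, e8, e10, eq_sub_of_add_eq e3, e1, e2, dL]
    simp only [Pi.sub_apply, inner_sub_left, inner_add_left, inner_neg_left, inner_mulE_transpose,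
      inner_sub_right, inner_add_right]
    ring
  rw [integral_congr_ae hpt, integral_sub, integral_add, c0, c1, hy.2] at hparts
  · rw [dualW_apply, dualLp_apply, firstVariation]
    simp only [inner_neg_left] at hparts ⊢
    linarith
  · exact hdL
  · exact hiu
  · exact hdL.add hiu
  · exact hiv

/-- A functional is a subgradient of the value function exactly when it bounds the first variation
of the objective from below along all feasible directions. -/
lemma mem_subdifferential_V_iff_le_firstVariation (q : ENNReal) [ENNReal.HolderConjugate p q]
    (h2 : P.A2) (hp : p ≠ ⊤) (hconv : Convex ℝ P.𝒰) {w : E n × LpI p k}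
    {z : Sobolev p n × LpI p m} (h : P.IsSolution z w) (φ : StrongDual ℝ (E n × LpI p k)) :
    φ ∈ subdifferential P.V w ↔
      ∀ w', ∀ z' ∈ P.G w' ∩ P.K, φ (w' - w) ≤ P.firstVariation z w z' w' := by
  rw [mem_subdifferential_V_iff h]
  refine ⟨fun hφ w' z' hz' => ?_,
    fun hφ w' z' hz' => (hφ w' z' hz').trans (firstVariation_le q h2 hp z z' w w')⟩
  refine ge_of_tendsto (tendsto_quotient_J q h2 hp z z' w w') ?_
  filter_upwards [Ioc_mem_nhdsGT (zero_lt_one' ℝ)] with s hs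
  have hle := hφ (w + s • (w' - w)) (z + s • (z' - z)) ⟨add_smul_sub_mem_G h.1.1 hz'.1 s,
    hconv.add_smul_sub_mem h.1.2 hz'.2 ⟨hs.1.le, hs.2⟩⟩
  rw [add_sub_cancel_left, map_smul, smul_eq_mul] at hle
  rwa [le_inv_mul_iff₀ hs.1]

/-- The only candidate for a subgradient of the value function is the parameter part of the first
variation, and it is one exactly when the control part is an outward normal of the constraint
set. -/
lemma mem_subdifferential_V_iff_eq_dualW {q : ENNReal} [Fact (1 ≤ q)]
    [ENNReal.HolderConjugate p q] (h1 : P.A1) (h2 : P.A2) (hp : p ≠ ⊤) (hconv : Convex ℝ P.𝒰)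
    {w : E n × LpI p k} {z : Sobolev p n × LpI p m} (h : P.IsSolution z w)
    {y : Sobolev q n} (hy : P.SolvesAdjoint z w y) {us : LpI q m} {θs : LpI q k}
    (hus : ∀ᵐ t ∂leb, us t = mulE (P.B t).transpose (y t) - P.Lu t (z.1 t) (z.2 t) (w.2 t))
    (hθs : ∀ᵐ t ∂leb, θs t = -mulE (P.C t).transpose (y t) + P.Lv t (z.1 t) (z.2 t) (w.2 t))
    (φ : StrongDual ℝ (E n × LpI p k)) :
    φ ∈ subdifferential P.V w ↔
      φ = dualW p (-y 0) θs ∧ dualLp p us ∈ normalCone P.𝒰 z.2 := by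
  rw [mem_subdifferential_V_iff_le_firstVariation q h2 hp hconv h]
  have hfv : ∀ w', ∀ z' ∈ P.G w', P.firstVariation z w z' w' =
      dualW p (-y 0) θs (w' - w) - dualLp p us (z'.2 - z.2) := fun w' z' hz' =>
    firstVariation_eq h2 hp h.1.1 hz' hy hus hθs
  refine ⟨fun hφ => ⟨?_, fun u hu => ?_⟩, ?_⟩
  · -- Keeping the optimal control fixed leaves the parameter increment `d` free.
    have hle : ∀ d, φ d ≤ dualW p (-y 0) θs d := fun d => by
      obtain ⟨x, hx⟩ := exists_mem_G h1 (w + d) z.2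
      have := hφ (w + d) (x, z.2) ⟨hx, h.1.2⟩
      rw [hfv _ _ hx] at this
      simpa using this
    refine ContinuousLinearMap.ext fun d => le_antisymm (hle d) ?_
    have := hle (-d)
    rw [map_neg, map_neg] at this
    exact neg_le_neg_iff.1 this
  · -- With the parameter fixed only the control increment remains.
    obtain ⟨x, hx⟩ := exists_mem_G h1 w u
    have := hφ w (x, u) ⟨hx, hu⟩
    rw [hfv _ _ hx] at this
    simpa using this
  · rintro ⟨rfl, hN⟩ w' z' hz'
    rw [hfv _ _ hz'.1]
    have := hN z'.2 hz'.2
    linarith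

/-! ### The adjoint problem -/

lemma existsUnique_solvesAdjoint {q : ENNReal} [Fact (1 ≤ q)] [ENNReal.HolderConjugate p q]
    (h1 : P.A1) (h2 : P.A2) (hp : p ≠ ⊤) (z : Sobolev p n × LpI p m) (w : E n × LpI p k) :
    ∃! y : Sobolev q n, P.SolvesAdjoint z w y := by
  have hLx := (memLp_gradients (q := q) h2 hp (z.1.memLp p) (Lp.memLp z.2) (Lp.memLp w.2)).1
  refine (existsUnique_congr fun y => ?_).2
    (existsUnique_linearODE h1.1.transpose.neg hLx (Or.inr rfl) (-gradient P.g (z.1 1)))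
  refine and_congr_left fun _ => eventually_congr (Eventually.of_forall fun t => ?_)
  rw [mulE_neg, eq_neg_add_iff_add_eq, add_comm]

/-- The initial value of the adjoint state in terms of the terminal cost and the integrals of the
adjoint equation. -/
lemma neg_adjoint_zero_eq {q : ENNReal} [Fact (1 ≤ q)] [ENNReal.HolderConjugate p q]
    (h1 : P.A1) (h2 : P.A2) (hp : p ≠ ⊤) {z : Sobolev p n × LpI p m} {w : E n × LpI p k}
    {y : Sobolev q n} (hy : P.SolvesAdjoint z w y) :
    -y 0 = gradient P.g (z.1 1) + (∫ t in (0 : ℝ)..1, P.Lx t (z.1 t) (z.2 t) (w.2 t)) -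
      ∫ t in (0 : ℝ)..1, mulE (P.A t).transpose (y t) := by
  have hLx := (memLp_gradients (q := q) h2 hp (z.1.memLp p) (Lp.memLp z.2) (Lp.memLp w.2)).1
  have hftc := y.eq_add_integral_deriv (left_mem_Icc.2 zero_le_one) (right_mem_Icc.2 zero_le_one)
  rw [add_sub_assoc, integral_leb, integral_leb, ← integral_sub (hLx.integrable Fact.out)
    ((h1.1.transpose.memLp (y.memLp q)).integrable Fact.out)]
  rw [integral_leb, hy.2] at hftc
  have hcongr : ∫ t, deriv y t ∂leb =
      ∫ t, P.Lx t (z.1 t) (z.2 t) (w.2 t) - mulE (P.A t).transpose (y t) ∂leb :=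
    integral_congr_ae (hy.1.mono fun t ht => eq_sub_of_add_eq ht)
  rw [← hcongr, neg_eq_iff_eq_neg.1 hftc]
  abel

end ControlProblem

end ControlSubdiff

end

theorem mainTheorem1 (p q : ENNReal) [Fact (1 ≤ p)] [Fact (1 ≤ q)] [ENNReal.HolderConjugate p q]
    (hp : p ≠ ⊤) (n m k : ℕ) (P : ControlSubdiff.ControlProblem p n m k)
    (hconv : Convex ℝ P.𝒰) (hint : (interior P.𝒰).Nonempty)
    (h1 : P.A1) (h2 : P.A2) (h3 : P.A3 q) (h4 : P.A4)
    (wbar : ControlSubdiff.E n × ControlSubdiff.LpI p k)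
    (hV : P.V wbar ≠ ⊤ ∧ P.V wbar ≠ ⊥)
    (xbar : ControlSubdiff.Sobolev p n) (ubar : ControlSubdiff.LpI p m)
    (hsol : P.IsSolution (xbar, ubar) wbar) :
    (∃ y : ControlSubdiff.Sobolev q n,
      (P.SolvesAdjoint (xbar, ubar) wbar y ∧
        ∀ y' : ControlSubdiff.Sobolev q n, P.SolvesAdjoint (xbar, ubar) wbar y' → y' = y) ∧
      ∃ us : ControlSubdiff.LpI q m,
        (∀ᵐ t ∂ControlSubdiff.leb,
          us t = ControlSubdiff.mulE (P.B t).transpose (y t)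
            - P.Lu t (xbar t) (ubar t) (wbar.2 t)) ∧
        ∀ (αs : ControlSubdiff.E n) (θs : ControlSubdiff.LpI q k),
          ControlSubdiff.dualW p αs θs ∈ ControlSubdiff.subdifferential P.V wbar ↔
            αs = gradient P.g (xbar 1)
                + (∫ t in (0 : ℝ)..1, P.Lx t (xbar t) (ubar t) (wbar.2 t))
                - (∫ t in (0 : ℝ)..1, ControlSubdiff.mulE (P.A t).transpose (y t)) ∧
            (∀ᵐ t ∂ControlSubdiff.leb,
              θs t = -ControlSubdiff.mulE (P.C t).transpose (y t)
                + P.Lv t (xbar t) (ubar t) (wbar.2 t)) ∧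
            ControlSubdiff.dualLp p us ∈ ControlSubdiff.normalCone P.𝒰 ubar) ∧
    (ControlSubdiff.subdifferential P.V wbar = ∅ ∨
      ∃ (αs : ControlSubdiff.E n) (θs : ControlSubdiff.LpI q k),
        ControlSubdiff.subdifferential P.V wbar = {ControlSubdiff.dualW p αs θs}) := by
  open ControlSubdiff ControlProblem in
  obtain ⟨y, hy, hyu⟩ := existsUnique_solvesAdjoint (q := q) h1 h2 hp (xbar, ubar) wbar
  obtain ⟨-, hLu, hLv⟩ := memLp_gradients (q := q) h2 hp (xbar.memLp p) (Lp.memLp ubar)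
    (Lp.memLp wbar.2)
  have hu := (h1.2.1.transpose.memLp (y.memLp q)).sub hLu
  have hθ := (h1.2.2.transpose.memLp (y.memLp q)).neg.add hLv
  have hus := hu.coeFn_toLp
  have hθs := hθ.coeFn_toLp
  have key := mem_subdifferential_V_iff_eq_dualW h1 h2 hp hconv hsol hy hus hθs
  refine ⟨⟨y, ⟨hy, hyu⟩, hu.toLp _, hus, fun αs θs => ?_⟩, ?_⟩
  · rw [key, dualW_inj, and_assoc, neg_adjoint_zero_eq h1 h2 hp hy]
    refine and_congr_right fun _ => and_congr_left fun _ => ?_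
    rw [Lp.ext_iff]
    exact ⟨fun h => Filter.EventuallyEq.trans h hθs,
      fun h => Filter.EventuallyEq.trans h hθs.symm⟩
  · by_cases hN : dualLp p (hu.toLp _) ∈ normalCone P.𝒰 ubar
    · exact Or.inr ⟨_, _, Set.ext fun φ => (key φ).trans (and_iff_left hN)⟩
    · exact Or.inl (Set.eq_empty_of_forall_notMem fun φ hφ => hN ((key φ).1 hφ).2)
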